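/- Let $v\ge 2$ be an integer and let $N_v$ be the free two-step nilpotent Lie group on $v$ generators. Write its elements as $\exp(X+A)$, with $X\in\mathcal V=\mathrm{span}(X_1,\dots,X_v)$ and $A\in\mathcal Z=\mathrm{span}(X_{i,j}=[X_i,X_j],\ i<j)$, where $\mathcal V$ and $\mathcal Z$ carry the Euclidean norms for which these families are orthonormal. Let $dn$ be the Haar measure given by Lebesgue measure on $\mathcal V\oplus\mathcal Z$, let $r.\exp(X+A)=\exp(rX+r^2A)$ be the dilations, $|\exp(X+A)|=(\|X\|^4+\|A\|^2)^{1/4}$ the Korányi norm, and $Q=v^2$ the homogeneous dimension. Let $\mu$ be the measure on the unit sphere $\{|n|=1\}$ with $$\int_{N_v} f(n)\,dn=\int_0^\infty\!\!\int f(r.n)\,d\mu(n)\,r^{Q-1}\,dr ,$$ let $\mu_s$ be its image under the dilation by $s>0$, and let $(f*\mu_s)(n)=\int f(nm^{-1})\,d\mu_s(m)$. For Schwartz functions $f:N_v\to\mathbb C$ define the spherical maximal function $\mathcal A f(n)=\sup_{r>0}|(f*\mu_r)(n)|$ and, for $j\ge1$, the square functions $$S^j f(n)=\Big(\int_0^\infty|\partial_s^j(f*\mu_s)(n)|^2\,s^{2j-1}\,ds\Big)^{1/2}.$$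 Say that $S^j$ satisfies an $L^2$-estimate if there is $C>0$ with $\|S^jf\|_{L^2}\le C\|f\|_{L^2}$ for all Schwartz functions $f$, and that $\mathcal A$ satisfies an $L^p$-inequality if there is $C>0$ with $\|\mathcal Af\|_{L^p}\le C\|f\|_{L^p}$ for all Schwartz functions $f$ (in particular for all smooth compactly supported $f$). (a) If $S^1$ satisfies an $L^2$-estimate, then $\mathcal A$ satisfies an $L^p$-inequality for every $2\le p\le\infty$. (b) Let $v>2$ and let $h$ be an integer with $1<h<(Q-2)/2$. If $S^j$ satisfies an $L^2$-estimate for every integer $j$ with $1<j\le h$, then $\mathcal A$ satisfies an $L^p$-inequality for every $\dfrac{2h}{2h-1}<p\le\infty$. -/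

import Mathlib

open MeasureTheory Set
open scoped ENNReal NNReal SchwartzMap

namespace KoranyiSphere

/-- The first layer: the span of the generators `X_1, …, X_v`, with the Euclidean norm for which
they are orthonormal. -/
abbrev Layer1 (v : ℕ) : Type := EuclideanSpace ℝ (Fin v)

/-- The second layer (the centre): the span of the vectors `X_{i,j} = [X_i, X_j]`, `i < j`, with the
Euclidean norm for which they are orthonormal. -/
abbrev Layer2 (v : ℕ) : Type := EuclideanSpace ℝ {p : Fin v × Fin v // p.1 < p.2}

/-- The free two-step nilpotent Lie group `N_v` on `v` generators, in exponential coordinates: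
`(X, A)` stands for `exp (X + A)`, with `X` in the first layer and `A` in the second layer of the
free two-step nilpotent Lie algebra. The additive, normed and measure structures are those of the
Lie algebra (in particular `volume`, the product of the Lebesgue measures of the two layers, is the
Haar measure `dn`, and Schwartz functions are those of the Lie algebra); the group law is the
multiplicative structure defined below. -/
abbrev N (v : ℕ) : Type := Layer1 v × Layer2 v

/-- The bracket of two vectors of the first layer: the bilinear alternating map with
`[X_i, X_j] = X_{i,j}` for `i < j`. -/
noncomputable def bracket {v : ℕ} (X Y : Layer1 v) : Layer2 v :=
  WithLp.toLp 2 fun p => X p.1.1 * Y p.1.2 - X p.1.2 * Y p.1.1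

/-- The Lie bracket of the free two-step nilpotent Lie algebra: the second layer is central. -/
noncomputable def lieBracket {v : ℕ} (n m : N v) : N v := (0, bracket n.1 m.1)

/-- The group law, by the Baker-Campbell-Hausdorff formula
`exp a exp b = exp (a + b + [a, b] / 2)`. -/
noncomputable instance (v : ℕ) : Mul (N v) where
  mul n m := n + m + (1 / 2 : ℝ) • lieBracket n m

noncomputable instance (v : ℕ) : One (N v) where
  one := 0

noncomputable instance (v : ℕ) : Inv (N v) where
  inv n := -n

@[simp] theorem mul_snd {v : ℕ} (n m : N v) :
    (n * m).2 = n.2 + m.2 + (1 / 2 : ℝ) • bracket n.1 m.1 := rfl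
@[simp] theorem mul_fst {v : ℕ} (n m : N v) : (n * m).1 = n.1 + m.1 :=
  (show n.1 + m.1 + (1 / 2 : ℝ) • (0 : Layer1 v) = n.1 + m.1 by simp)
@[simp] theorem one_fst {v : ℕ} : (1 : N v).1 = 0 := rfl
@[simp] theorem one_snd {v : ℕ} : (1 : N v).2 = 0 := rfl
@[simp] theorem inv_fst {v : ℕ} (n : N v) : (n⁻¹).1 = -n.1 := rfl
@[simp] theorem inv_snd {v : ℕ} (n : N v) : (n⁻¹).2 = -n.2 := rfl

noncomputable instance (v : ℕ) : Group (N v) :=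
  Group.ofLeftAxioms
    (by
      intro a b c
      apply Prod.ext
      · ext i
        simp only [mul_fst, PiLp.add_apply]
        ring
      · ext p
        simp [bracket]
        ring)
    (by
      intro a
      apply Prod.ext
      · simp
      · ext p
        simp [bracket])
    (by
      intro a
      apply Prod.ext
      · simp
      · ext p
        simp [bracket]
        ring)

/-- The dilations `r.exp (X + A) = exp (r X + r² A)`. -/
noncomputable def dil {v : ℕ} (r : ℝ) (n : N v) : N v := (r • n.1, r ^ 2 • n.2)

/-- The homogeneous Korányi norm `(‖X‖⁴ + ‖A‖²)^{1/4}`. -/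
noncomputable def koranyiNorm {v : ℕ} (n : N v) : ℝ := (‖n.1‖ ^ 4 + ‖n.2‖ ^ 2) ^ (1 / 4 : ℝ)

/-- The homogeneous dimension `Q`: the dimension of the first layer plus twice the dimension of the
second layer. -/
noncomputable def homDim (v : ℕ) : ℕ :=
  Module.finrank ℝ (Layer1 v) + 2 * Module.finrank ℝ (Layer2 v)

theorem homDim_eq (v : ℕ) : homDim v = v ^ 2 := by
  have h : Fintype.card {p : Fin v × Fin v // p.1 < p.2} = ∑ i ∈ Finset.range v, i := by
    rw [Fintype.card_subtype, Finset.card_filter, Fintype.sum_prod_type_right]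
    rw [← Fin.sum_univ_eq_sum_range (fun i => i)]
    refine Finset.sum_congr rfl fun i _ => ?_
    rw [← Finset.card_filter]
    have : (Finset.univ.filter fun x : Fin v => x < i) = Finset.Iio i := by ext; simp
    rw [this, Fin.card_Iio]
  have h2 := Finset.sum_range_id_mul_two v
  rw [homDim, finrank_euclideanSpace, finrank_euclideanSpace, h, Fintype.card_fin]
  cases v with
  | zero => simp
  | succ k =>
    simp only [Nat.add_sub_cancel] at h2
    nlinarith

/-- The measure `μ` on the Korányi unit sphere `{n : koranyiNorm n = 1}`, regarded as a measure on
`N v`: the mass of `E` is `Q` times the volume of the part of the unit ball lying on the dilation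
rays through `E`. It is the measure for which integration in polar coordinates
`∫ f(n) dn = ∫_0^∞ ∫ f(r.n) dμ(n) r^{Q-1} dr` holds (see `lintegral_polar` below). -/
noncomputable def sphereMeasure (v : ℕ) : Measure (N v) :=
  (homDim v : ℝ≥0∞) •
    ((volume : Measure (N v)).restrict {n | koranyiNorm n ≤ 1}).map
      fun n => dil (koranyiNorm n)⁻¹ n

theorem measurable_dil {v : ℕ} : Measurable fun q : ℝ × N v => dil q.1 q.2 := by
  have h1 : Measurable fun q : ℝ × N v => q.2.1 := measurable_fst.comp measurable_snd
  have h2 : Measurable fun q : ℝ × N v => q.2.2 := measurable_snd.comp measurable_snd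
  exact (measurable_fst.smul h1).prodMk ((measurable_fst.pow_const 2).smul h2)

theorem measurable_koranyiNorm {v : ℕ} : Measurable (koranyiNorm : N v → ℝ) := by
  have h1 : Measurable fun q : N v => q.1 := measurable_fst
  have h2 : Measurable fun q : N v => q.2 := measurable_snd
  exact ((h1.norm.pow_const 4).add (h2.norm.pow_const 2)).pow_const _

theorem koranyiNorm_nonneg {v : ℕ} (n : N v) : 0 ≤ koranyiNorm n :=
  Real.rpow_nonneg (by positivity) _

theorem koranyiNorm_eq_zero {v : ℕ} {n : N v} : koranyiNorm n = 0 ↔ n = 0 := by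
  rw [koranyiNorm, Real.rpow_eq_zero (by positivity) (by norm_num)]
  constructor
  · intro h
    have h1 : ‖n.1‖ ^ 4 = 0 := by nlinarith [sq_nonneg ‖n.2‖, sq_nonneg (‖n.1‖ ^ 2)]
    have h2 : ‖n.2‖ ^ 2 = 0 := by nlinarith [sq_nonneg ‖n.2‖, sq_nonneg (‖n.1‖ ^ 2)]
    exact Prod.ext (by simpa using h1) (by simpa using h2)
  · rintro rfl
    simp

theorem koranyiNorm_dil {v : ℕ} {r : ℝ} (hr : 0 ≤ r) (n : N v) :
    koranyiNorm (dil r n) = r * koranyiNorm n := by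
  have : koranyiNorm (dil r n) = (r ^ 4 * (‖n.1‖ ^ 4 + ‖n.2‖ ^ 2)) ^ (1 / 4 : ℝ) := by
    simp only [koranyiNorm, dil, norm_smul, Real.norm_eq_abs, abs_of_nonneg hr,
      abs_of_nonneg (sq_nonneg r)]
    congr 1
    ring
  rw [this, Real.mul_rpow (by positivity) (by positivity), koranyiNorm]
  congr 1
  rw [← Real.rpow_natCast, ← Real.rpow_mul hr]
  norm_num

theorem dil_dil {v : ℕ} (r s : ℝ) (n : N v) : dil r (dil s n) = dil (r * s) n := by
  apply Prod.ext <;> simp [dil, smul_smul, mul_pow]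

theorem lintegral_comp_smul {E : Type*} [NormedAddCommGroup E] [NormedSpace ℝ E]
    [FiniteDimensional ℝ E] [MeasurableSpace E] [BorelSpace E] (μ : Measure E)
    [μ.IsAddHaarMeasure] {r : ℝ} (hr : 0 < r) {f : E → ℝ≥0∞} (hf : Measurable f) :
    ∫⁻ x, f x ∂μ = ENNReal.ofReal r ^ Module.finrank ℝ E * ∫⁻ x, f (r • x) ∂μ := by
  rw [← lintegral_map hf (measurable_const_smul r), Measure.map_addHaar_smul μ hr.ne',
    lintegral_smul_measure, smul_eq_mul, ← mul_assoc, ← ENNReal.ofReal_pow hr.le,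
    ← ENNReal.ofReal_mul (by positivity), abs_of_pos (by positivity),
    mul_inv_cancel₀ (by positivity)]
  simp

theorem lintegral_comp_dil {v : ℕ} {r : ℝ} (hr : 0 < r) {f : N v → ℝ≥0∞} (hf : Measurable f) :
    ∫⁻ n, f n = ENNReal.ofReal r ^ homDim v * ∫⁻ n, f (dil r n) := by
  have hd : Measurable fun n : N v => f (dil r n) :=
    hf.comp (measurable_dil.comp measurable_prodMk_left)
  have e1 : ∫⁻ n, f n = ∫⁻ x : Layer1 v, ∫⁻ a : Layer2 v, f (x, a) :=
    lintegral_prod _ hf.aemeasurable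
  have e2 : ∫⁻ n, f (dil r n) = ∫⁻ x : Layer1 v, ∫⁻ a : Layer2 v, f (r • x, r ^ 2 • a) :=
    lintegral_prod _ hd.aemeasurable
  have m1 : Measurable fun x : Layer1 v => ∫⁻ a : Layer2 v, f (x, a) :=
    hf.lintegral_prod_right'
  rw [e1, e2, lintegral_comp_smul volume hr m1, homDim, pow_add, mul_assoc,
    ← lintegral_const_mul' (ENNReal.ofReal r ^ (2 * _))]
  · congr 1
    refine lintegral_congr fun x => ?_
    have m2 : Measurable fun a : Layer2 v => f (r • x, a) := hf.comp measurable_prodMk_left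
    rw [lintegral_comp_smul volume (pow_pos hr 2) m2, ENNReal.ofReal_pow hr.le, ← pow_mul]
  · exact ENNReal.pow_ne_top ENNReal.ofReal_ne_top

theorem lintegral_Ioi_comp_mul {c : ℝ} (hc : 0 < c) {g : ℝ → ℝ≥0∞} (hg : Measurable g) :
    ∫⁻ r in Ioi (0 : ℝ), g r = ENNReal.ofReal c * ∫⁻ r in Ioi (0 : ℝ), g (c * r) := by
  rw [← lintegral_indicator measurableSet_Ioi, ← lintegral_indicator measurableSet_Ioi,
    lintegral_comp_smul volume hc (hg.indicator measurableSet_Ioi)]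
  simp [indicator, hc]

theorem lintegral_Ici_inv_pow {c : ℝ} (hc : 0 < c) {k : ℕ} (hk : 0 < k) :
    ∫⁻ r in Ici c, ENNReal.ofReal ((r ^ (k + 1))⁻¹) = ENNReal.ofReal ((k * c ^ k)⁻¹) := by
  have hk' : (0 : ℝ) < k := by exact_mod_cast hk
  have e : ∀ r ∈ Ioi c, r ^ (-(k : ℝ) - 1) = (r ^ (k + 1))⁻¹ := by
    intro r hr
    have hr0 : 0 < r := hc.trans hr
    rw [← Real.rpow_natCast r (k + 1), ← Real.rpow_neg hr0.le]
    push_cast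
    congr 1
    ring
  have hint := (integrableOn_Ioi_rpow_of_lt (a := -(k : ℝ) - 1) (by linarith) hc).congr_fun e
    measurableSet_Ioi
  rw [setLIntegral_congr (Ioi_ae_eq_Ici' (by simp)).symm,
    ← ofReal_integral_eq_lintegral_ofReal hint, ← setIntegral_congr_fun measurableSet_Ioi e,
    integral_Ioi_rpow_of_lt (by linarith) hc]
  · congr 1
    have : -(k : ℝ) - 1 + 1 = -k := by ring
    rw [this, Real.rpow_neg hc.le, Real.rpow_natCast]
    field_simp
  · refine (ae_restrict_iff' measurableSet_Ioi).2 (Filter.Eventually.of_forall fun r hr => ?_)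
    have hr0 : 0 < r := hc.trans hr
    positivity

theorem measurable_radialProj {v : ℕ} :
    Measurable fun n : N v => dil (koranyiNorm n)⁻¹ n :=
  measurable_dil.comp (measurable_koranyiNorm.inv.prodMk measurable_id)

/-- Integration in polar coordinates. -/
theorem lintegral_polar {v : ℕ} (hv : 1 ≤ v) {f : N v → ℝ≥0∞} (hf : Measurable f) :
    ∫⁻ n, f n = ∫⁻ r in Ioi (0 : ℝ),
      (∫⁻ n, f (dil r n) ∂(sphereMeasure v)) * ENNReal.ofReal (r ^ (homDim v - 1)) := by
  have hQ : 0 < homDim v := by rw [homDim_eq]; positivity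
  have hQ' : (0 : ℝ) < homDim v := by exact_mod_cast hQ
  set Q := homDim v with hQdef
  have hball : MeasurableSet {n : N v | koranyiNorm n ≤ 1} :=
    measurable_koranyiNorm measurableSet_Iic
  have hfd : Measurable fun q : ℝ × N v => f (dil q.1 q.2) := hf.comp measurable_dil
  -- the spherical mean as an integral over the unit ball
  have h1 : ∀ r : ℝ, ∫⁻ n, f (dil r n) ∂(sphereMeasure v) =
      Q * ∫⁻ n, {n : N v | koranyiNorm n ≤ 1}.indicator
        (fun n => f (dil (r * (koranyiNorm n)⁻¹) n)) n := by
    intro r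
    have : Measurable fun n : N v => f (dil r n) := hfd.comp measurable_prodMk_left
    rw [sphereMeasure, lintegral_smul_measure, lintegral_map this measurable_radialProj,
      lintegral_indicator hball, smul_eq_mul]
    simp only [dil_dil, hQdef]
  have hG : Measurable fun q : ℝ × N v => {n : N v | koranyiNorm n ≤ 1}.indicator
        (fun n => f (dil (q.1 * (koranyiNorm n)⁻¹) n)) q.2 := by
    have m0 : Measurable fun q : ℝ × N v => koranyiNorm q.2 :=
      measurable_koranyiNorm.comp measurable_snd
    have m1 : Measurable fun q : ℝ × N v => f (dil (q.1 * (koranyiNorm q.2)⁻¹) q.2) :=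
      hf.comp (measurable_dil.comp ((measurable_fst.mul m0.inv).prodMk measurable_snd))
    exact m1.indicator (m0 measurableSet_Iic)
  have hpow : Measurable fun r : ℝ => ENNReal.ofReal (r ^ (Q - 1)) := by fun_prop
  -- substitution `r = ‖n‖ t` along each ray
  have h2 : ∀ n : N v, n ≠ 0 →
      ∫⁻ r in Ioi (0 : ℝ), {n : N v | koranyiNorm n ≤ 1}.indicator
        (fun n => f (dil (r * (koranyiNorm n)⁻¹) n)) n * ENNReal.ofReal (r ^ (Q - 1)) =
      ∫⁻ t in Ioi (0 : ℝ), {n : N v | koranyiNorm n ≤ 1}.indicator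
        (fun n => f (dil t n) * ENNReal.ofReal (koranyiNorm n ^ Q)) n *
          ENNReal.ofReal (t ^ (Q - 1)) := by
    intro n hn
    by_cases hn1 : koranyiNorm n ≤ 1
    swap
    · simp [indicator, hn1]
    have hpos : 0 < koranyiNorm n :=
      lt_of_le_of_ne (koranyiNorm_nonneg n) fun h => hn (koranyiNorm_eq_zero.1 h.symm)
    have mg : Measurable fun r : ℝ => f (dil (r * (koranyiNorm n)⁻¹) n) *
        ENNReal.ofReal (r ^ (Q - 1)) := by
      have : Measurable fun r : ℝ => f (dil (r * (koranyiNorm n)⁻¹) n) :=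
        hfd.comp ((measurable_id.mul_const _).prodMk measurable_const)
      exact this.mul hpow
    simp only [indicator, mem_ofPred_eq, hn1, if_true]
    rw [lintegral_Ioi_comp_mul hpos mg, ← lintegral_const_mul' _ _ ENNReal.ofReal_ne_top]
    refine setLIntegral_congr_fun measurableSet_Ioi fun t ht => ?_
    have ht0 : (0 : ℝ) < t := ht
    have e1 : koranyiNorm n * t * (koranyiNorm n)⁻¹ = t := by field_simp
    have e2 : koranyiNorm n ^ Q = koranyiNorm n * koranyiNorm n ^ (Q - 1) := by
      rw [← pow_succ', Nat.sub_add_cancel hQ]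
    simp only [e1]
    rw [mul_pow, ENNReal.ofReal_mul (by positivity), e2, ENNReal.ofReal_mul hpos.le]
    ring
  -- substitution `n = t⁻¹.m` in the group
  have h3 : ∀ t : ℝ, 0 < t →
      (∫⁻ n, {n : N v | koranyiNorm n ≤ 1}.indicator
        (fun n => f (dil t n) * ENNReal.ofReal (koranyiNorm n ^ Q)) n) *
          ENNReal.ofReal (t ^ (Q - 1)) =
      ∫⁻ m, f m * ENNReal.ofReal (koranyiNorm m ^ Q) *
        (Ici (koranyiNorm m)).indicator (fun t => ENNReal.ofReal ((t ^ (Q + 1))⁻¹)) t := by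
    intro t ht
    have mm : Measurable fun m : N v => f m * ENNReal.ofReal (koranyiNorm m ^ Q) *
        (Ici (koranyiNorm m)).indicator (fun t => ENNReal.ofReal ((t ^ (Q + 1))⁻¹)) t := by
      have a1 : Measurable fun m : N v => f m * ENNReal.ofReal (koranyiNorm m ^ Q) :=
        hf.mul (measurable_koranyiNorm.pow_const Q).ennreal_ofReal
      have a2 : Measurable fun m : N v => {m : N v | koranyiNorm m ≤ t}.indicator
          (fun _ => ENNReal.ofReal ((t ^ (Q + 1))⁻¹)) m :=
        measurable_const.indicator (measurable_koranyiNorm measurableSet_Iic)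
      exact a1.mul a2
    rw [lintegral_comp_dil ht mm, ← lintegral_const_mul' _ _
      (ENNReal.pow_ne_top ENNReal.ofReal_ne_top), ← lintegral_mul_const' _ _
      ENNReal.ofReal_ne_top]
    refine lintegral_congr fun n => ?_
    have hiff : t * koranyiNorm n ≤ t ↔ koranyiNorm n ≤ 1 := by
      constructor <;> intro h <;> nlinarith
    simp only [koranyiNorm_dil ht.le, indicator, mem_Ici, mem_ofPred_eq, hiff]
    split_ifs with hn1
    swap
    · simp
    have e : t ^ (Q - 1) * koranyiNorm n ^ Q =
        t ^ Q * (t * koranyiNorm n) ^ Q * (t ^ (Q + 1))⁻¹ := by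
      obtain ⟨k, hk⟩ : ∃ k, Q = k + 1 := ⟨Q - 1, by omega⟩
      rw [hk, Nat.add_sub_cancel]
      field_simp
      ring
    have k0 := koranyiNorm_nonneg n
    have e' := congrArg ENNReal.ofReal e
    rw [ENNReal.ofReal_mul (by positivity), ENNReal.ofReal_mul (by positivity),
      ENNReal.ofReal_mul (by positivity), ENNReal.ofReal_pow ht.le Q] at e'
    rw [mul_assoc, mul_comm (ENNReal.ofReal (koranyiNorm n ^ Q)), e']
    ring
  have hz : ∀ᵐ n : N v, n ≠ 0 := by
    have : Nontrivial (Layer1 v) := by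
      have : Nonempty (Fin v) := ⟨⟨0, hv⟩⟩
      infer_instance
    simp [ae_iff, Measure.volume_eq_prod]
  symm
  calc
    _ = ∫⁻ r in Ioi (0 : ℝ), Q * ∫⁻ n, {n : N v | koranyiNorm n ≤ 1}.indicator
        (fun n => f (dil (r * (koranyiNorm n)⁻¹) n)) n * ENNReal.ofReal (r ^ (Q - 1)) := by
      refine lintegral_congr fun r => ?_
      rw [h1, lintegral_mul_const' _ _ ENNReal.ofReal_ne_top, mul_assoc]
    _ = Q * ∫⁻ n, ∫⁻ r in Ioi (0 : ℝ), {n : N v | koranyiNorm n ≤ 1}.indicator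
        (fun n => f (dil (r * (koranyiNorm n)⁻¹) n)) n * ENNReal.ofReal (r ^ (Q - 1)) := by
      rw [lintegral_const_mul' _ _ (ENNReal.natCast_ne_top Q), lintegral_lintegral_swap]
      exact (hG.mul (hpow.comp measurable_fst)).aemeasurable
    _ = Q * ∫⁻ n, ∫⁻ t in Ioi (0 : ℝ), {n : N v | koranyiNorm n ≤ 1}.indicator
        (fun n => f (dil t n) * ENNReal.ofReal (koranyiNorm n ^ Q)) n *
          ENNReal.ofReal (t ^ (Q - 1)) := by
      congr 1
      exact lintegral_congr_ae (hz.mono fun n hn => h2 n hn)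
    _ = Q * ∫⁻ t in Ioi (0 : ℝ), ∫⁻ m, f m * ENNReal.ofReal (koranyiNorm m ^ Q) *
        (Ici (koranyiNorm m)).indicator (fun t => ENNReal.ofReal ((t ^ (Q + 1))⁻¹)) t := by
      rw [lintegral_lintegral_swap]
      · congr 1
        refine setLIntegral_congr_fun measurableSet_Ioi fun t ht => ?_
        rw [← h3 t ht, lintegral_mul_const' _ _ ENNReal.ofReal_ne_top]
      · have m0 : Measurable fun q : N v × ℝ => koranyiNorm q.1 :=
          measurable_koranyiNorm.comp measurable_fst
        have m1 : Measurable fun q : N v × ℝ =>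
            f (dil q.2 q.1) * ENNReal.ofReal (koranyiNorm q.1 ^ Q) :=
          (hfd.comp measurable_swap).mul (m0.pow_const Q).ennreal_ofReal
        exact ((m1.indicator (m0 measurableSet_Iic)).mul
          (hpow.comp measurable_snd)).aemeasurable
    _ = Q * ∫⁻ m, ∫⁻ t in Ioi (0 : ℝ), f m * ENNReal.ofReal (koranyiNorm m ^ Q) *
        (Ici (koranyiNorm m)).indicator (fun t => ENNReal.ofReal ((t ^ (Q + 1))⁻¹)) t := by
      rw [lintegral_lintegral_swap]
      have m0 : Measurable fun q : ℝ × N v => koranyiNorm q.2 :=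
        measurable_koranyiNorm.comp measurable_snd
      have m1 : Measurable fun q : ℝ × N v =>
          f q.2 * ENNReal.ofReal (koranyiNorm q.2 ^ Q) :=
        (hf.comp measurable_snd).mul (m0.pow_const Q).ennreal_ofReal
      have m2 : Measurable fun q : ℝ × N v => {q : ℝ × N v | koranyiNorm q.2 ≤ q.1}.indicator
          (fun q => ENNReal.ofReal ((q.1 ^ (Q + 1))⁻¹)) q :=
        (measurable_fst.pow_const (Q + 1)).inv.ennreal_ofReal.indicator
          (measurableSet_le m0 measurable_fst)
      exact (m1.mul m2).aemeasurable
    _ = ∫⁻ n, f n := by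
      rw [← lintegral_const_mul' _ _ (ENNReal.natCast_ne_top Q)]
      refine lintegral_congr_ae (hz.mono fun n hn => ?_)
      have hpos : 0 < koranyiNorm n :=
        lt_of_le_of_ne (koranyiNorm_nonneg n) fun h => hn (koranyiNorm_eq_zero.1 h.symm)
      have mi : Measurable fun t : ℝ =>
          (Ici (koranyiNorm n)).indicator (fun t => ENNReal.ofReal ((t ^ (Q + 1))⁻¹)) t :=
        (measurable_id.pow_const (Q + 1)).inv.ennreal_ofReal.indicator measurableSet_Ici
      have hsub : Ici (koranyiNorm n) ∩ Ioi 0 = Ici (koranyiNorm n) :=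
        inter_eq_left.2 fun t ht => hpos.trans_le ht
      simp only
      rw [lintegral_const_mul _ mi, setLIntegral_indicator measurableSet_Ici, hsub,
        lintegral_Ici_inv_pow hpos hQ]
      have e : (Q : ℝ) * koranyiNorm n ^ Q * (Q * koranyiNorm n ^ Q)⁻¹ = 1 :=
        mul_inv_cancel₀ (by positivity)
      have e' := congrArg ENNReal.ofReal e
      rw [ENNReal.ofReal_mul (by positivity), ENNReal.ofReal_mul (by positivity),
        ENNReal.ofReal_natCast, ENNReal.ofReal_one] at e'
      calc _ = f n * (Q * ENNReal.ofReal (koranyiNorm n ^ Q) *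
            ENNReal.ofReal ((Q * koranyiNorm n ^ Q)⁻¹)) := by ring
        _ = f n := by rw [e', mul_one]

/-- `μ` lives on the Korányi unit sphere. -/
theorem sphereMeasure_compl {v : ℕ} (hv : 1 ≤ v) :
    sphereMeasure v {n | koranyiNorm n = 1}ᶜ = 0 := by
  have hm : MeasurableSet {n : N v | koranyiNorm n = 1} :=
    measurable_koranyiNorm (measurableSet_singleton 1)
  have hsub : (fun n : N v => dil (koranyiNorm n)⁻¹ n) ⁻¹' {n | koranyiNorm n = 1}ᶜ ⊆ {0} := by
    intro n hn
    by_contra h0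
    refine hn ?_
    have hpos : koranyiNorm n ≠ 0 := fun h => h0 (koranyiNorm_eq_zero.1 h)
    simp only [mem_ofPred_eq]
    rw [koranyiNorm_dil (inv_nonneg.2 (koranyiNorm_nonneg n)), inv_mul_cancel₀ hpos]
  have h0 : (volume : Measure (N v)) {0} = 0 := by
    have : Nontrivial (Layer1 v) := by
      have : Nonempty (Fin v) := ⟨⟨0, hv⟩⟩
      infer_instance
    simp [Measure.volume_eq_prod]
  have h1 : ((volume : Measure (N v)).restrict {n | koranyiNorm n ≤ 1})
      ((fun n : N v => dil (koranyiNorm n)⁻¹ n) ⁻¹' {n | koranyiNorm n = 1}ᶜ) = 0 :=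
    measure_mono_null hsub (Measure.absolutelyContinuous_of_le Measure.restrict_le_self h0)
  rw [sphereMeasure, Measure.smul_apply, Measure.map_apply measurable_radialProj hm.compl, h1]
  simp

/-- The dilated measure `μ_s`: `⟨μ_s, f⟩ = ⟨μ, f(s.)⟩`. -/
noncomputable def dilMeasure {v : ℕ} (s : ℝ) (μ : Measure (N v)) : Measure (N v) :=
  μ.map (dil s)

/-- The convolution `(f * μ)(n) = ∫ f (n m⁻¹) dμ(m)` of a function and a measure. -/
noncomputable def conv {v : ℕ} (μ : Measure (N v)) (f : N v → ℂ) (n : N v) : ℂ :=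
  ∫ m, f (n * m⁻¹) ∂μ

/-- The dilated operator `T_r f = (T f(r.)) (r⁻¹.)`. -/
noncomputable def dilOp {v : ℕ} (r : ℝ) (T : (N v → ℂ) → N v → ℂ) (f : N v → ℂ) (n : N v) : ℂ :=
  T (fun m => f (dil r m)) (dil r⁻¹ n)

/-- The maximal function `f ↦ sup_{r > 0} |T_r f|` associated to an operator `T`, with values in
`[0, ∞]`. -/
noncomputable def maximalFunction {v : ℕ} (T : (N v → ℂ) → N v → ℂ) (f : N v → ℂ) (n : N v) :
    ℝ≥0∞ :=
  ⨆ r ∈ Ioi (0 : ℝ), ‖dilOp r T f n‖ₑ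

/-- The spherical maximal function. -/
noncomputable def sphericalMaximal (v : ℕ) : (N v → ℂ) → N v → ℝ≥0∞ :=
  maximalFunction (conv (sphereMeasure v))

/-- The square function `S^j f (n) = (∫_0^∞ |∂_s^j (f * μ_s)(n)|² s^{2j-1} ds)^{1/2}`, with values in
`[0, ∞]`. -/
noncomputable def squareFunction (v j : ℕ) (f : N v → ℂ) (n : N v) : ℝ≥0∞ :=
  (∫⁻ s in Ioi (0 : ℝ),
    ‖iteratedDeriv j (fun t : ℝ => conv (dilMeasure t (sphereMeasure v)) f n) s‖ₑ ^ 2 *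
      ENNReal.ofReal (s ^ (2 * j - 1))) ^ (1 / 2 : ℝ)

/-- An `L^p`-inequality (`1 ≤ p ≤ ∞`) for a map `𝒯` from functions to `[0, ∞]`-valued functions:
`‖𝒯 f‖_p ≤ C ‖f‖_p` for all Schwartz functions `f` (in particular for all smooth compactly supported
functions). -/
def LpInequality {v : ℕ} (𝒯 : (N v → ℂ) → N v → ℝ≥0∞) (p : ℝ≥0∞) : Prop :=
  ∃ C : ℝ≥0, 0 < C ∧ ∀ f : 𝓢(N v, ℂ), eLpNorm (𝒯 f) p volume ≤ C * eLpNorm f p volume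

end KoranyiSphere

namespace KoranyiSphere

variable {v : ℕ}

/-! Fix `n` and put `F r = (f * μ_r)(n)`. The supremum of `|F r|` is reached by comparing `F r` with
weighted averages of `F` over the radii in `[r + rε, r + 2rε]`. At `ε = 1` polar coordinates turn
such an average into an integral over a solid region of size `r`, which the Hardy-Littlewood maximal
function controls. As `ε → 0` the average tends to a nonzero multiple of `F r`. It remains to pay
for each passage from `ε` to `ε / 2`.

The weight makes higher derivatives available: it is `φ⁽ᵏ⁾(u) / u` with `φ` a bump supported inside
`(1, 2)`. Differentiating `F (r + rεu)` in `ε` produces a factor `ru`, whose `u` cancels the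
denominator, and `k` integrations by parts leave `r (-rε)^k ∫ φ(u) F⁽ᵏ⁺¹⁾(r + rεu) du`
(`hasDerivAt_radialAvg`). By Cauchy-Schwarz this is at most `ε^(k - 1/2) S^(k+1) f(n)`, with all
powers of `r` cancelling, so the step from `ε` to `ε / 2` costs at most `ε^(k + 1/2) S^(k+1) f(n)`,
uniformly in `r` (`enorm_radialAvg_sub_half_le`).

For (a), `k = 0` and the `L²` costs at `ε = 2⁻ⁱ` form a convergent geometric series. For (b), `k + 1
= h`. Each difference is also bounded by `ε⁻¹` times the Hardy-Littlewood maximal function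
(`enorm_radialAvg_le_hlMaximal`), hence is of weak type `(1, 1)` with constant of order `ε⁻¹`.
Marcinkiewicz interpolation with the `L²` bound gives `q`-th power constants of order `ε^(2h(q-1) -
1)` (`strongType_diffMaximal`). These are summable when `q > 1 + 1/(2h)`, in particular when `q >
2h/(2h-1)`. Larger exponents follow by interpolation with the trivial `L^∞` bound. All interpolation
is carried out inside the Schwartz class, by a smooth truncation in height. -/

/-! ### Group law, dilations and invariance of the measure -/

theorem norm_bracket_le (X Y : Layer1 v) :
    ‖bracket X Y‖ ≤
      2 * (Fintype.card {p : Fin v × Fin v // p.1 < p.2} : ℝ) * (‖X‖ * ‖Y‖) := by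
  set c : ℝ := (Fintype.card {p : Fin v × Fin v // p.1 < p.2} : ℝ) with hc
  have hcoord : ∀ p, ‖(bracket X Y) p‖ ^ 2 ≤ (2 * (‖X‖ * ‖Y‖)) ^ 2 := by
    intro p
    refine pow_le_pow_left₀ (norm_nonneg _) ?_ 2
    have e : (bracket X Y) p = X p.1.1 * Y p.1.2 - X p.1.2 * Y p.1.1 := rfl
    rw [e]
    refine (norm_sub_le _ _).trans ?_
    rw [norm_mul, norm_mul]
    have h1 := PiLp.norm_apply_le X p.1.1
    have h2 := PiLp.norm_apply_le X p.1.2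
    have h3 := PiLp.norm_apply_le Y p.1.1
    have h4 := PiLp.norm_apply_le Y p.1.2
    have := mul_le_mul h1 h4 (norm_nonneg _) (norm_nonneg _)
    have := mul_le_mul h2 h3 (norm_nonneg _) (norm_nonneg _)
    linarith
  have hsum : ‖bracket X Y‖ ^ 2 ≤ c * (2 * (‖X‖ * ‖Y‖)) ^ 2 := by
    rw [EuclideanSpace.norm_sq_eq]
    refine (Finset.sum_le_sum fun p _ => hcoord p).trans_eq ?_
    simp [hc]
  -- `c` is a natural number; replacing `c` by `c ^ 2` avoids a square root in the constant.
  have hcc : c ≤ c ^ 2 := by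
    rw [hc]
    exact_mod_cast Nat.le_self_pow two_ne_zero _
  refine abs_le_of_sq_le_sq' ?_ (by positivity) |>.2
  calc _ ≤ c * (2 * (‖X‖ * ‖Y‖)) ^ 2 := hsum
    _ ≤ c ^ 2 * (2 * (‖X‖ * ‖Y‖)) ^ 2 := by gcongr
    _ = _ := by ring

theorem contDiff_mul : ContDiff ℝ ⊤ fun q : N v × N v => q.1 * q.2 := by
  have hb : ContDiff ℝ ⊤ fun q : N v × N v => lieBracket q.1 q.2 := by
    refine contDiff_const.prodMk ?_
    refine contDiff_euclidean.2 fun p => ?_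
    have h1 : ∀ i, ContDiff ℝ ⊤ fun q : N v × N v => q.1.1 i := fun i =>
      (contDiff_euclidean.1 (contDiff_fst.comp contDiff_fst)) i
    have h2 : ∀ i, ContDiff ℝ ⊤ fun q : N v × N v => q.2.1 i := fun i =>
      (contDiff_euclidean.1 (contDiff_fst.comp contDiff_snd)) i
    exact ((h1 _).mul (h2 _)).sub ((h1 _).mul (h2 _))
  exact (contDiff_fst.add contDiff_snd).add (hb.const_smul (1 / 2 : ℝ))

theorem contDiff_dil : ContDiff ℝ ⊤ fun q : ℝ × N v => dil q.1 q.2 :=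
  (contDiff_fst.smul (contDiff_fst.comp contDiff_snd)).prodMk
    ((contDiff_fst.pow 2).smul (contDiff_snd.comp contDiff_snd))

instance : ContinuousMul (N v) := ⟨contDiff_mul.continuous⟩

instance : ContinuousInv (N v) := ⟨continuous_neg (G := N v)⟩

theorem dil_mul (r : ℝ) (n m : N v) : dil r (n * m) = dil r n * dil r m := by
  apply Prod.ext
  · simp [dil]
  · ext p
    simp [dil, bracket]
    ring

theorem dil_inv (r : ℝ) (n : N v) : dil r n⁻¹ = (dil r n)⁻¹ := by
  apply Prod.ext <;> simp [dil]

theorem dil_one (n : N v) : dil 1 n = n := by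
  apply Prod.ext <;> simp [dil]

/-- By Fubini: left multiplication translates the first layer by a fixed vector and, over each fixed
`x`, translates the second layer by a vector depending only on `n` and `x`. -/
theorem measurePreserving_mul_left (n : N v) :
    MeasurePreserving (fun m : N v => n * m) volume volume := by
  have key : ∀ f : N v → ℝ≥0∞, Measurable f → ∫⁻ m, f (n * m) = ∫⁻ m, f m := by
    intro f hf
    have hf' : Measurable fun m : N v => f (n * m) :=
      hf.comp (measurable_const_mul n)
    have e1 : ∫⁻ n, f n = ∫⁻ x : Layer1 v, ∫⁻ a : Layer2 v, f (x, a) :=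
      lintegral_prod _ hf.aemeasurable
    have e2 : ∫⁻ m, f (n * m) = ∫⁻ x : Layer1 v, ∫⁻ a : Layer2 v, f (n * (x, a)) :=
      lintegral_prod _ hf'.aemeasurable
    rw [e1, e2, ← lintegral_add_left_eq_self (fun x => ∫⁻ a : Layer2 v, f (x, a)) n.1]
    refine lintegral_congr fun x => ?_
    rw [← lintegral_add_left_eq_self (fun a => f (n.1 + x, a))
      (n.2 + (1 / 2 : ℝ) • bracket n.1 x)]
    refine lintegral_congr fun a => ?_
    congr 1
    apply Prod.ext
    · simp
    · simp only [mul_snd]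
      abel
  refine ⟨measurable_const_mul n, ?_⟩
  ext s hs
  rw [Measure.map_apply (measurable_const_mul n) hs]
  have := key (s.indicator 1) (measurable_one.indicator hs)
  rw [lintegral_indicator_one hs] at this
  rw [← this, ← lintegral_indicator_one (measurable_const_mul n hs)]
  rfl

theorem lintegral_mul_left (n : N v) {f : N v → ℝ≥0∞} (hf : Measurable f) :
    ∫⁻ m, f (n * m) = ∫⁻ m, f m :=
  (measurePreserving_mul_left n).lintegral_comp hf

instance : (volume : Measure (N v)).IsAddHaarMeasure :=
  Measure.prod.instIsAddHaarMeasure (volume : Measure (Layer1 v)) (volume : Measure (Layer2 v))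

instance : (volume : Measure (N v)).IsNegInvariant :=
  ⟨((LinearIsometryEquiv.neg ℝ (E := Layer1 v)).measurePreserving.prod
    (LinearIsometryEquiv.neg ℝ (E := Layer2 v)).measurePreserving).map_eq⟩

theorem lintegral_inv (f : N v → ℝ≥0∞) : ∫⁻ m, f m⁻¹ = ∫⁻ m, f m :=
  lintegral_neg_eq_self (μ := volume) f

/-! ### Boxes and their engulfing property -/

/-- The anisotropic box of radius `r`, comparable to the Korányi ball. -/
def box (v : ℕ) (r : ℝ) : Set (N v) := {n | ‖n.1‖ ≤ r ∧ ‖n.2‖ ≤ r ^ 2}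

theorem measurableSet_box (r : ℝ) : MeasurableSet (box v r) :=
  (measurableSet_le measurable_fst.norm measurable_const).inter
    (measurableSet_le measurable_snd.norm measurable_const)

theorem inv_mem_box {r : ℝ} {n : N v} : n⁻¹ ∈ box v r ↔ n ∈ box v r := by
  simp [box]

theorem box_mono {r s : ℝ} (hr : 0 ≤ r) (hrs : r ≤ s) : box v r ⊆ box v s := fun _ hn =>
  ⟨hn.1.trans hrs, hn.2.trans (pow_le_pow_left₀ hr hrs 2)⟩

theorem koranyiNorm_pow_four (n : N v) : koranyiNorm n ^ 4 = ‖n.1‖ ^ 4 + ‖n.2‖ ^ 2 := by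
  rw [koranyiNorm, ← Real.rpow_natCast, ← Real.rpow_mul (by positivity)]
  norm_num

theorem mem_box_of_koranyiNorm_le {r : ℝ} {n : N v} (h : koranyiNorm n ≤ r) : n ∈ box v r := by
  have h0 := koranyiNorm_nonneg n
  have hr := h0.trans h
  have h4 : ‖n.1‖ ^ 4 + ‖n.2‖ ^ 2 ≤ r ^ 4 := by
    rw [← koranyiNorm_pow_four]
    exact pow_le_pow_left₀ h0 h 4
  constructor
  · refine le_of_pow_le_pow_left₀ four_ne_zero hr ?_
    nlinarith [sq_nonneg ‖n.2‖]
  · refine le_of_pow_le_pow_left₀ two_ne_zero (by positivity) ?_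
    calc ‖n.2‖ ^ 2 ≤ r ^ 4 := by nlinarith [pow_nonneg (norm_nonneg n.1) 4]
      _ = (r ^ 2) ^ 2 := by ring

theorem dil_mem_box {r s : ℝ} (hr : 0 < r) (n : N v) : dil r n ∈ box v (r * s) ↔ n ∈ box v s := by
  have h2 : 0 < r ^ 2 := by positivity
  simp [box, dil, norm_smul, abs_of_pos hr, mul_pow, hr, h2]

theorem volume_box {r : ℝ} (hr : 0 < r) :
    volume (box v r) = ENNReal.ofReal r ^ homDim v * volume (box v 1) := by
  rw [← lintegral_indicator_one (measurableSet_box r), ← lintegral_indicator_one (measurableSet_box 1),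
    lintegral_comp_dil hr (measurable_one.indicator (measurableSet_box r))]
  congr 2
  ext n
  have := dil_mem_box (s := 1) hr n
  rw [mul_one] at this
  by_cases h : n ∈ box v 1
  · rw [indicator_of_mem h, indicator_of_mem (this.2 h)]; rfl
  · rw [indicator_of_notMem h, indicator_of_notMem (mt this.1 h)]

theorem isBounded_box (r : ℝ) : Bornology.IsBounded (box v r) := by
  refine (Metric.isBounded_closedBall (x := (0 : N v)) (r := max r (r ^ 2))).subset fun n hn => ?_
  rw [mem_closedBall_zero_iff, Prod.norm_def]
  exact max_le_max hn.1 hn.2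

theorem volume_box_lt_top (r : ℝ) : volume (box v r) < ∞ := (isBounded_box r).measure_lt_top

theorem volume_box_one_pos : 0 < volume (box v 1) := by
  refine (Metric.measure_ball_pos volume (0 : N v) one_pos).trans_le (measure_mono fun n hn => ?_)
  rw [mem_ball_zero_iff, Prod.norm_def, max_lt_iff] at hn
  exact ⟨hn.1.le, by simpa using hn.2.le⟩

/-- The constant of the quasi-triangle inequality for boxes. -/
noncomputable def boxConst (v : ℕ) : ℝ := 1 + Fintype.card {p : Fin v × Fin v // p.1 < p.2}

theorem one_le_boxConst : 1 ≤ boxConst v := by simp [boxConst]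

/-- The half bracket has norm at most `c r s`, with `c` the number of pairs `i < j`, and `r² + s² +
c r s ≤ ((1 + c)(r + s))²`. This replaces a triangle inequality for the Korányi norm. -/
theorem mul_mem_box {r s : ℝ} {n m : N v} (hn : n ∈ box v r) (hm : m ∈ box v s) :
    n * m ∈ box v (boxConst v * (r + s)) := by
  have hr : 0 ≤ r := (norm_nonneg _).trans hn.1
  have hs : 0 ≤ s := (norm_nonneg _).trans hm.1
  have hK := one_le_boxConst (v := v)
  constructor
  · rw [mul_fst]
    calc _ ≤ ‖n.1‖ + ‖m.1‖ := norm_add_le _ _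
      _ ≤ r + s := add_le_add hn.1 hm.1
      _ ≤ _ := le_mul_of_one_le_left (by positivity) hK
  · rw [mul_snd]
    set c : ℝ := (Fintype.card {p : Fin v × Fin v // p.1 < p.2} : ℝ) with hc
    have hc0 : 0 ≤ c := by rw [hc]; positivity
    have hb : ‖(1 / 2 : ℝ) • bracket n.1 m.1‖ ≤ c * (r * s) := by
      rw [norm_smul]
      have h1 := norm_bracket_le n.1 m.1
      rw [← hc] at h1
      have h2 : ‖n.1‖ * ‖m.1‖ ≤ r * s := mul_le_mul hn.1 hm.1 (norm_nonneg _) hr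
      norm_num
      nlinarith
    calc _ ≤ ‖n.2‖ + ‖m.2‖ + ‖(1 / 2 : ℝ) • bracket n.1 m.1‖ := norm_add₃_le
      _ ≤ r ^ 2 + s ^ 2 + c * (r * s) := add_le_add (add_le_add hn.2 hm.2) hb
      _ ≤ (boxConst v * (r + s)) ^ 2 := by
        rw [boxConst, ← hc]
        nlinarith [mul_nonneg hr hs, mul_nonneg hc0 (mul_nonneg hr hs), sq_nonneg (r + s),
          mul_nonneg hc0 (sq_nonneg (r + s)), mul_nonneg (mul_nonneg hc0 hc0) (sq_nonneg (r + s)),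
          mul_nonneg hc0 (sq_nonneg r), mul_nonneg hc0 (sq_nonneg s)]

/-- The left translate of the box of radius `r` centred at `n`. -/
def leftBox (n : N v) (r : ℝ) : Set (N v) := {x | n⁻¹ * x ∈ box v r}

theorem measurableSet_leftBox (n : N v) (r : ℝ) : MeasurableSet (leftBox n r) :=
  measurable_const_mul n⁻¹ (measurableSet_box r)

theorem mem_leftBox_self (n : N v) {r : ℝ} (hr : 0 ≤ r) : n ∈ leftBox n r := by
  change n⁻¹ * n ∈ box v r
  rw [inv_mul_cancel]
  simp [box, hr]

theorem volume_leftBox (n : N v) (r : ℝ) : volume (leftBox n r) = volume (box v r) :=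
  (measurePreserving_mul_left n⁻¹).measure_preimage (measurableSet_box r).nullMeasurableSet

/-- With `y` a common point, `m⁻¹ x = (m⁻¹ y)(n⁻¹ y)⁻¹(n⁻¹ x)` is a product of elements of boxes of
radii `s`, `r`, `r`; the quasi-triangle inequality is applied twice. This is the enlargement needed
for the Vitali covering. -/
theorem leftBox_subset {n m : N v} {r s : ℝ} (h : (leftBox n r ∩ leftBox m s).Nonempty)
    (hrs : r ≤ 2 * s) :
    leftBox n r ⊆ leftBox m (boxConst v * (boxConst v * 3 + 2) * s) := by
  obtain ⟨y, hy1, hy2⟩ := h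
  intro x hx
  have hr : 0 ≤ r := (norm_nonneg _).trans hx.1
  have hs : 0 ≤ s := by linarith
  have hK := one_le_boxConst (v := v)
  have e : m⁻¹ * x = m⁻¹ * y * (n⁻¹ * y)⁻¹ * (n⁻¹ * x) := by group
  change m⁻¹ * x ∈ box v _
  rw [e]
  have h1 : m⁻¹ * y ∈ box v s := hy2
  have h2 : (n⁻¹ * y)⁻¹ ∈ box v r := inv_mem_box.2 hy1
  have h3 : n⁻¹ * x ∈ box v r := hx
  refine box_mono (by positivity) ?_ (mul_mem_box (mul_mem_box h1 h2) h3)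
  have : boxConst v * (s + r) + r ≤ (boxConst v * 3 + 2) * s := by nlinarith
  calc _ ≤ boxConst v * ((boxConst v * 3 + 2) * s) := by gcongr
    _ = _ := by ring

/-- Boxes are symmetric, and the measure is invariant under inversion and left translation. Hence
right convolution averages `g` over left translates, the sets to which the maximal function must be
adapted. -/
theorem setLIntegral_leftBox (n : N v) (r : ℝ) {g : N v → ℝ≥0∞} (hg : Measurable g) :
    ∫⁻ m in box v r, g (n * m⁻¹) = ∫⁻ x in leftBox n r, g x := by
  rw [← lintegral_indicator (measurableSet_box r), ← lintegral_indicator (measurableSet_leftBox n r),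
    ← lintegral_inv, ← lintegral_mul_left n (hg.indicator (measurableSet_leftBox n r))]
  refine lintegral_congr fun m => ?_
  have : n * m ∈ leftBox n r ↔ m⁻¹ ∈ box v r := by
    rw [inv_mem_box]
    simp [leftBox]
  by_cases h : m⁻¹ ∈ box v r
  · rw [indicator_of_mem h, indicator_of_mem (this.2 h), inv_inv]
  · rw [indicator_of_notMem h, indicator_of_notMem (mt this.1 h)]

instance : IsFiniteMeasure (sphereMeasure v) := by
  have h : volume {n : N v | koranyiNorm n ≤ 1} < ∞ :=
    (measure_mono fun n hn => mem_box_of_koranyiNorm_le hn).trans_lt (volume_box_lt_top 1)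
  refine ⟨?_⟩
  rw [sphereMeasure, Measure.smul_apply, Measure.map_apply measurable_radialProj .univ,
    preimage_univ, Measure.restrict_apply_univ, smul_eq_mul]
  exact ENNReal.mul_lt_top (ENNReal.natCast_lt_top _) h

theorem ae_sphereMeasure_mem_box (hv : 1 ≤ v) : ∀ᵐ m ∂(sphereMeasure v), m ∈ box v 1 := by
  have : ∀ᵐ m ∂(sphereMeasure v), koranyiNorm m = 1 := sphereMeasure_compl hv
  exact this.mono fun m hm => mem_box_of_koranyiNorm_le hm.le

/-! ### The Hardy-Littlewood maximal function -/

/-- The (dyadic) Hardy-Littlewood maximal function on `N v` over left translates of boxes. -/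
noncomputable def hlMaximal (g : N v → ℝ≥0∞) (n : N v) : ℝ≥0∞ :=
  ⨆ k : ℤ, (ENNReal.ofReal ((2 : ℝ) ^ k) ^ homDim v)⁻¹ * ∫⁻ x in leftBox n ((2 : ℝ) ^ k), g x

theorem ofReal_pow_ne_zero {r : ℝ} (hr : 0 < r) (k : ℕ) : ENNReal.ofReal r ^ k ≠ 0 :=
  pow_ne_zero _ (ENNReal.ofReal_pos.2 hr).ne'

theorem ofReal_pow_ne_top (r : ℝ) (k : ℕ) : ENNReal.ofReal r ^ k ≠ ∞ :=
  ENNReal.pow_ne_top ENNReal.ofReal_ne_top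

theorem setLIntegral_box_le_hlMaximal {g : N v → ℝ≥0∞} (hg : Measurable g) (n : N v) {r : ℝ}
    (hr : 0 < r) :
    ∫⁻ m in box v r, g (n * m⁻¹) ≤ ENNReal.ofReal (2 * r) ^ homDim v * hlMaximal g n := by
  -- Rounding `r` up to the dyadic radius `2 ^ (k + 1) ≤ 2 r` is the source of the factor `2`.
  obtain ⟨k, hk1, hk2⟩ := exists_mem_Ioc_zpow hr one_lt_two
  have h2 : (2 : ℝ) ^ (k + 1) ≤ 2 * r := by
    rw [zpow_add_one₀ two_ne_zero]
    linarith
  have hp : (0 : ℝ) < 2 ^ (k + 1) := by positivity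
  calc ∫⁻ m in box v r, g (n * m⁻¹)
      ≤ ∫⁻ m in box v (2 ^ (k + 1)), g (n * m⁻¹) := lintegral_mono_set (box_mono hr.le hk2)
    _ = ENNReal.ofReal (2 ^ (k + 1)) ^ homDim v * ((ENNReal.ofReal (2 ^ (k + 1)) ^ homDim v)⁻¹ *
          ∫⁻ x in leftBox n (2 ^ (k + 1)), g x) := by
      rw [setLIntegral_leftBox _ _ hg, ← mul_assoc,
        ENNReal.mul_inv_cancel (ofReal_pow_ne_zero hp _) (ofReal_pow_ne_top _ _), one_mul]
    _ ≤ _ := by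
      gcongr
      exact le_iSup (fun k : ℤ => (ENNReal.ofReal ((2 : ℝ) ^ k) ^ homDim v)⁻¹ *
        ∫⁻ x in leftBox n ((2 : ℝ) ^ k), g x) (k + 1)

/-- The constant in the weak type `(1, 1)` estimate for the Hardy-Littlewood maximal function. -/
noncomputable def weakConst (v : ℕ) : ℝ≥0∞ :=
  ENNReal.ofReal (boxConst v * (boxConst v * 3 + 2)) ^ homDim v * volume (box v 1)

theorem weakConst_ne_top : weakConst v ≠ ∞ :=
  ENNReal.mul_ne_top (ofReal_pow_ne_top _ _) (volume_box_lt_top 1).ne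

theorem weakConst_ne_zero : weakConst v ≠ 0 := by
  have := one_le_boxConst (v := v)
  exact mul_ne_zero (ofReal_pow_ne_zero (by positivity) _) volume_box_one_pos.ne'

/-- The Hardy-Littlewood maximal function is of weak type `(1, 1)`. -/
theorem mul_volume_lt_hlMaximal_le (hv : 1 ≤ v) (g : N v → ℝ≥0∞) {l : ℝ≥0∞} (hl : l ≠ 0) :
    l * volume {n | l < hlMaximal g n} ≤ weakConst v * ∫⁻ n, g n := by
  by_cases hfin : ∫⁻ n, g n = ∞
  · rw [hfin, ENNReal.mul_top weakConst_ne_zero]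
    exact le_top
  have hQ : homDim v ≠ 0 := by rw [homDim_eq]; positivity
  have hK := one_le_boxConst (v := v)
  -- A scale witnessing the large average is chosen at each point of the level set; the value `0`
  -- elsewhere only makes the choice total.
  have hk : ∀ n : N v, ∃ k : ℤ, n ∈ {n | l < hlMaximal g n} →
      l * ENNReal.ofReal ((2 : ℝ) ^ k) ^ homDim v < ∫⁻ x in leftBox n ((2 : ℝ) ^ k), g x := by
    intro n
    by_cases hn : l < hlMaximal g n
    · obtain ⟨k, hk⟩ := lt_iSup_iff.1 hn
      refine ⟨k, fun _ => ?_⟩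
      have hp : (0 : ℝ) < 2 ^ k := by positivity
      rwa [mul_comm, ← div_eq_mul_inv, ENNReal.lt_div_iff_mul_lt
        (Or.inl (ofReal_pow_ne_zero hp _)) (Or.inl (ofReal_pow_ne_top _ _))] at hk
    · exact ⟨0, fun h => absurd h hn⟩
  choose k hk using hk
  -- The covering lemma needs bounded radii `ρ`. Here `l ρ^Q < ∫ g`, and `ρ ≤ ρ^Q` once `ρ > 1`, so
  -- `ρ ≤ max 1 (∫ g / l)`.
  obtain ⟨u, huE, hudisj, hucov⟩ := Vitali.exists_disjoint_subfamily_covering_enlargement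
    (fun n : N v => leftBox n ((2 : ℝ) ^ k n)) {n | l < hlMaximal g n}
    (fun n => (2 : ℝ) ^ k n) 2 one_lt_two (fun n _ => by positivity)
    (max 1 ((∫⁻ n, g n) / l).toReal) (by
      intro n hn
      by_contra! hlt
      obtain ⟨h1, h2⟩ := max_lt_iff.1 hlt
      have hle : ENNReal.ofReal ((2 : ℝ) ^ k n) ≤ (∫⁻ n, g n) / l := by
        have hltop : l ≠ ∞ := (show l < hlMaximal g n from hn).ne_top
        rw [ENNReal.le_div_iff_mul_le (Or.inl hl) (Or.inl hltop), mul_comm]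
        refine le_trans ?_ ((hk n hn).le.trans (setLIntegral_le_lintegral _ _))
        gcongr
        exact le_self_pow (ENNReal.one_le_ofReal.2 h1.le) hQ
      have htop : (∫⁻ n, g n) / l ≠ ∞ := ENNReal.div_ne_top hfin hl
      exact absurd ((ENNReal.ofReal_le_iff_le_toReal htop).1 hle) (not_le.2 h2))
    (fun n _ => ⟨n, mem_leftBox_self n (by positivity)⟩)
  -- Disjoint sets of positive volume form a countable family.
  have hucount : u.Countable := by
    have := Measure.countable_meas_pos_of_disjoint_iUnion (μ := (volume : Measure (N v)))
      (As := fun i : u => leftBox (i : N v) ((2 : ℝ) ^ k i))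
      (fun i => measurableSet_leftBox _ _) (fun i j hij => hudisj i.2 j.2 (by
        simpa [Subtype.ext_iff] using hij))
    have huniv : {i : u | 0 < volume (leftBox (i : N v) ((2 : ℝ) ^ k i))} = univ := by
      refine eq_univ_of_forall fun i => ?_
      have hp : (0 : ℝ) < 2 ^ k i := by positivity
      change 0 < volume _
      rw [volume_leftBox, volume_box hp]
      exact ENNReal.mul_pos (ofReal_pow_ne_zero hp _) volume_box_one_pos.ne'
    rw [huniv] at this
    exact countable_coe_iff.1 (countable_univ_iff.1 this)
  have hcov : {n | l < hlMaximal g n} ⊆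
      ⋃ b ∈ u, leftBox b (boxConst v * (boxConst v * 3 + 2) * (2 : ℝ) ^ k b) := by
    intro n hn
    obtain ⟨b, hb, hne, hδ⟩ := hucov n hn
    exact mem_biUnion hb (leftBox_subset hne hδ (mem_leftBox_self n (by positivity)))
  have hcountable : Countable u := hucount.to_subtype
  calc l * volume {n | l < hlMaximal g n}
      ≤ l * ∑' b : u, volume (leftBox (b : N v)
          (boxConst v * (boxConst v * 3 + 2) * (2 : ℝ) ^ k b)) := by
        gcongr
        exact (measure_mono hcov).trans (measure_biUnion_le _ hucount _)
    _ = ∑' b : u, weakConst v * (l * ENNReal.ofReal ((2 : ℝ) ^ k b) ^ homDim v) := by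
        rw [← ENNReal.tsum_mul_left]
        refine tsum_congr fun b => ?_
        rw [volume_leftBox, volume_box (by positivity), ENNReal.ofReal_mul (by positivity), mul_pow,
          weakConst]
        ring
    _ ≤ ∑' b : u, weakConst v * ∫⁻ x in leftBox (b : N v) ((2 : ℝ) ^ k b), g x := by
        refine ENNReal.tsum_le_tsum fun b => ?_
        gcongr
        exact (hk b (huE b.2)).le
    _ = weakConst v * ∫⁻ x in ⋃ b : u, leftBox (b : N v) ((2 : ℝ) ^ k b), g x := by
        rw [ENNReal.tsum_mul_left, lintegral_iUnion (fun b => measurableSet_leftBox _ _)]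
        intro i j hij
        exact hudisj i.2 j.2 (by simpa [Subtype.ext_iff] using hij)
    _ ≤ _ := by
        gcongr
        exact Measure.restrict_le_self

/-! ### Layer-cake integrals -/

theorem lintegral_Ioo_rpow {s c : ℝ} (hs : 0 < s) (hc : 0 < c) :
    ∫⁻ t in Ioo 0 c, ENNReal.ofReal (t ^ (s - 1)) = ENNReal.ofReal (c ^ s / s) := by
  have hint : IntegrableOn (fun t : ℝ => t ^ (s - 1)) (Ioo 0 c) :=
    (intervalIntegral.integrableOn_Ioo_rpow_iff hc).2 (by linarith)
  rw [← ofReal_integral_eq_lintegral_ofReal hint, ← integral_Ioc_eq_integral_Ioo,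
    ← intervalIntegral.integral_of_le hc.le, integral_rpow (Or.inl (by linarith)), sub_add_cancel,
    Real.zero_rpow hs.ne', sub_zero]
  filter_upwards [ae_restrict_mem measurableSet_Ioo] with t ht
  exact Real.rpow_nonneg ht.1.le _

theorem lintegral_Ici_rpow_neg {s c : ℝ} (hs : 0 < s) (hc : 0 < c) :
    ∫⁻ t in Ici c, ENNReal.ofReal (t ^ (-s - 1)) = ENNReal.ofReal (c ^ (-s) / s) := by
  rw [setLIntegral_congr (Ioi_ae_eq_Ici' (by simp)).symm,
    ← ofReal_integral_eq_lintegral_ofReal (integrableOn_Ioi_rpow_of_lt (by linarith) hc),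
    integral_Ioi_rpow_of_lt (by linarith) hc, sub_add_cancel, neg_div_neg_eq]
  filter_upwards [ae_restrict_mem measurableSet_Ioi] with t ht
  exact Real.rpow_nonneg (hc.trans ht).le _

theorem lintegral_rpow_eq_of_ne_top {α : Type*} [MeasurableSpace α] {μ : Measure α}
    {T : α → ℝ≥0∞} (hT : Measurable T) (hfin : ∀ x, T x ≠ ∞)
    {q : ℝ} (hq : 0 < q) :
    ∫⁻ x, T x ^ q ∂μ = ENNReal.ofReal q * ∫⁻ t in Ioi (0 : ℝ),
      μ {x | ENNReal.ofReal t < T x} * ENNReal.ofReal (t ^ (q - 1)) := by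
  have h := lintegral_rpow_eq_lintegral_meas_lt_mul μ
    (Filter.Eventually.of_forall fun x => (T x).toReal_nonneg) hT.ennreal_toReal.aemeasurable hq
  calc _ = ∫⁻ x, ENNReal.ofReal ((T x).toReal ^ q) ∂μ := by
        refine lintegral_congr fun x => ?_
        rw [← ENNReal.ofReal_rpow_of_nonneg ENNReal.toReal_nonneg hq.le,
          ENNReal.ofReal_toReal (hfin x)]
    _ = _ := by
        rw [h]
        congr 1
        refine setLIntegral_congr_fun measurableSet_Ioi fun t ht => ?_
        have ht0 : (0 : ℝ) < t := ht
        congr 3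
        ext x
        exact (ENNReal.ofReal_lt_iff_lt_toReal ht0.le (hfin x)).symm

section LayerCake

variable {α : Type*} [MeasurableSpace α] {μ : Measure α} [SFinite μ]

/-- Tonelli: integrating in `t` first, the point `x` contributes `g(x)^p ∫ t^(q-p-1) dt` over `0 < t
< g(x)/b`, which converges at `0` because `p < q`. It handles the high part in Marcinkiewicz
interpolation. -/
theorem lintegral_rpow_mul_lintegral_lt {g : α → ℝ} (hg : Measurable g) (hg0 : ∀ x, 0 ≤ g x)
    {p q b : ℝ} (hp : 0 < p) (hpq : p < q) (hb : 0 < b) :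
    ∫⁻ t in Ioi (0 : ℝ), ENNReal.ofReal (t ^ (-p)) *
        (∫⁻ x, {x | b * t < g x}.indicator (fun x => ENNReal.ofReal (g x ^ p)) x ∂μ) *
        ENNReal.ofReal (t ^ (q - 1)) =
      ENNReal.ofReal (b ^ (p - q) / (q - p)) * ∫⁻ x, ENNReal.ofReal (g x ^ q) ∂μ := by
  have hm : Measurable fun z : ℝ × α => ENNReal.ofReal (z.1 ^ (q - p - 1)) *
      {x | b * z.1 < g x}.indicator (fun x => ENNReal.ofReal (g x ^ p)) z.2 := by
    have h1 : Measurable fun z : ℝ × α => ENNReal.ofReal (z.1 ^ (q - p - 1)) :=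
      (measurable_fst.pow_const _).ennreal_ofReal
    have h2 : Measurable fun z : ℝ × α => {z : ℝ × α | b * z.1 < g z.2}.indicator
        (fun z => ENNReal.ofReal (g z.2 ^ p)) z :=
      ((hg.comp measurable_snd).pow_const _).ennreal_ofReal.indicator
        (measurableSet_lt (measurable_fst.const_mul b) (hg.comp measurable_snd))
    exact h1.mul h2
  have hi : ∀ t : ℝ, Measurable fun x =>
      {x | b * t < g x}.indicator (fun x => ENNReal.ofReal (g x ^ p)) x := fun t =>
    (hg.pow_const _).ennreal_ofReal.indicator (measurableSet_lt measurable_const hg)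
  calc _ = ∫⁻ t in Ioi (0 : ℝ), ∫⁻ x, ENNReal.ofReal (t ^ (q - p - 1)) *
        {x | b * t < g x}.indicator (fun x => ENNReal.ofReal (g x ^ p)) x ∂μ := by
        refine setLIntegral_congr_fun measurableSet_Ioi fun t ht => ?_
        have ht0 : (0 : ℝ) < t := ht
        rw [lintegral_const_mul _ (hi t), mul_right_comm, ← ENNReal.ofReal_mul (by positivity),
          ← Real.rpow_add ht0]
        congr 3
        ring
    _ = ∫⁻ x, (∫⁻ t in Ioi (0 : ℝ), ENNReal.ofReal (t ^ (q - p - 1)) *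
        {x | b * t < g x}.indicator (fun x => ENNReal.ofReal (g x ^ p)) x) ∂μ :=
        lintegral_lintegral_swap hm.aemeasurable
    _ = ∫⁻ x, ENNReal.ofReal (b ^ (p - q) / (q - p)) * ENNReal.ofReal (g x ^ q) ∂μ := by
        refine lintegral_congr fun x => ?_
        have hqp : 0 < q - p := sub_pos.2 hpq
        rcases (hg0 x).eq_or_lt with h0 | hpos
        · rw [← h0, Real.zero_rpow (hp.trans hpq).ne']
          simp only [ENNReal.ofReal_zero, mul_zero]
          rw [setLIntegral_congr_fun (g := fun _ => 0) measurableSet_Ioi]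
          · simp
          · intro t ht
            simp [indicator, ← h0, Real.zero_rpow hp.ne']
        · have e : ∀ t ∈ Ioi (0 : ℝ), ENNReal.ofReal (t ^ (q - p - 1)) *
              {x | b * t < g x}.indicator (fun x => ENNReal.ofReal (g x ^ p)) x =
              (Ioo 0 (g x / b)).indicator
                (fun t => ENNReal.ofReal (g x ^ p) * ENNReal.ofReal (t ^ (q - p - 1))) t := by
            intro t ht
            have : t ∈ Ioo 0 (g x / b) ↔ b * t < g x := by
              rw [mem_Ioo, lt_div_iff₀ hb, mul_comm t]
              exact and_iff_right ht
            by_cases h : b * t < g x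
            · rw [indicator_of_mem (show x ∈ {x | b * t < g x} from h),
                indicator_of_mem (this.2 h), mul_comm]
            · rw [indicator_of_notMem (show x ∉ {x | b * t < g x} from h),
                indicator_of_notMem (mt this.1 h), mul_zero]
          rw [setLIntegral_congr_fun measurableSet_Ioi e, setLIntegral_indicator measurableSet_Ioo,
            inter_eq_left.2 (fun t ht => ht.1), lintegral_const_mul' _ _ ENNReal.ofReal_ne_top,
            lintegral_Ioo_rpow hqp (by positivity), ← ENNReal.ofReal_mul (by positivity),
            ← ENNReal.ofReal_mul (by positivity), Real.div_rpow hpos.le hb.le]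
          congr 1
          rw [show g x ^ q = g x ^ p * g x ^ (q - p) by rw [← Real.rpow_add hpos]; ring_nf,
            show b ^ (p - q) = (b ^ (q - p))⁻¹ by rw [← Real.rpow_neg hb.le]; ring_nf]
          field_simp
    _ = _ := lintegral_const_mul' _ _ ENNReal.ofReal_ne_top

/-- The counterpart for the low part: `t` now runs from `g(x)/b` to infinity, and `q < p` gives
convergence there. -/
theorem lintegral_rpow_mul_lintegral_le {g : α → ℝ} (hg : Measurable g) (hg0 : ∀ x, 0 ≤ g x)
    {p q b : ℝ} (hq : 0 < q) (hqp : q < p) (hb : 0 < b) :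
    ∫⁻ t in Ioi (0 : ℝ), ENNReal.ofReal (t ^ (-p)) *
        (∫⁻ x, {x | g x ≤ b * t}.indicator (fun x => ENNReal.ofReal (g x ^ p)) x ∂μ) *
        ENNReal.ofReal (t ^ (q - 1)) =
      ENNReal.ofReal (b ^ (p - q) / (p - q)) * ∫⁻ x, ENNReal.ofReal (g x ^ q) ∂μ := by
  have hm : Measurable fun z : ℝ × α => ENNReal.ofReal (z.1 ^ (-(p - q) - 1)) *
      {x | g x ≤ b * z.1}.indicator (fun x => ENNReal.ofReal (g x ^ p)) z.2 := by
    have h1 : Measurable fun z : ℝ × α => ENNReal.ofReal (z.1 ^ (-(p - q) - 1)) :=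
      (measurable_fst.pow_const _).ennreal_ofReal
    have h2 : Measurable fun z : ℝ × α => {z : ℝ × α | g z.2 ≤ b * z.1}.indicator
        (fun z => ENNReal.ofReal (g z.2 ^ p)) z :=
      ((hg.comp measurable_snd).pow_const _).ennreal_ofReal.indicator
        (measurableSet_le (hg.comp measurable_snd) (measurable_fst.const_mul b))
    exact h1.mul h2
  have hi : ∀ t : ℝ, Measurable fun x =>
      {x | g x ≤ b * t}.indicator (fun x => ENNReal.ofReal (g x ^ p)) x := fun t =>
    (hg.pow_const _).ennreal_ofReal.indicator (measurableSet_le hg measurable_const)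
  calc _ = ∫⁻ t in Ioi (0 : ℝ), ∫⁻ x, ENNReal.ofReal (t ^ (-(p - q) - 1)) *
        {x | g x ≤ b * t}.indicator (fun x => ENNReal.ofReal (g x ^ p)) x ∂μ := by
        refine setLIntegral_congr_fun measurableSet_Ioi fun t ht => ?_
        have ht0 : (0 : ℝ) < t := ht
        rw [lintegral_const_mul _ (hi t), mul_right_comm, ← ENNReal.ofReal_mul (by positivity),
          ← Real.rpow_add ht0]
        congr 3
        ring
    _ = ∫⁻ x, (∫⁻ t in Ioi (0 : ℝ), ENNReal.ofReal (t ^ (-(p - q) - 1)) *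
        {x | g x ≤ b * t}.indicator (fun x => ENNReal.ofReal (g x ^ p)) x) ∂μ :=
        lintegral_lintegral_swap hm.aemeasurable
    _ = ∫⁻ x, ENNReal.ofReal (b ^ (p - q) / (p - q)) * ENNReal.ofReal (g x ^ q) ∂μ := by
        refine lintegral_congr fun x => ?_
        have hpq : 0 < p - q := sub_pos.2 hqp
        -- Zeros of `g` are separated: there the power of `t` alone is not integrable near `0`, but
        -- its coefficient `g(x)^p` vanishes.
        rcases (hg0 x).eq_or_lt with h0 | hpos
        · rw [← h0, Real.zero_rpow hq.ne']
          simp only [ENNReal.ofReal_zero, mul_zero]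
          rw [setLIntegral_congr_fun (g := fun _ => 0) measurableSet_Ioi]
          · simp
          · intro t ht
            simp [indicator, ← h0, Real.zero_rpow (hq.trans hqp).ne']
        · have hsub : Ici (g x / b) ∩ Ioi 0 = Ici (g x / b) :=
            inter_eq_left.2 fun t ht => (div_pos hpos hb).trans_le ht
          have e : ∀ t ∈ Ioi (0 : ℝ), ENNReal.ofReal (t ^ (-(p - q) - 1)) *
              {x | g x ≤ b * t}.indicator (fun x => ENNReal.ofReal (g x ^ p)) x =
              (Ici (g x / b)).indicator
                (fun t => ENNReal.ofReal (g x ^ p) * ENNReal.ofReal (t ^ (-(p - q) - 1))) t := by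
            intro t ht
            have : t ∈ Ici (g x / b) ↔ g x ≤ b * t := by
              rw [mem_Ici, div_le_iff₀ hb, mul_comm t]
            by_cases h : g x ≤ b * t
            · rw [indicator_of_mem (show x ∈ {x | g x ≤ b * t} from h),
                indicator_of_mem (this.2 h), mul_comm]
            · rw [indicator_of_notMem (show x ∉ {x | g x ≤ b * t} from h),
                indicator_of_notMem (mt this.1 h), mul_zero]
          rw [setLIntegral_congr_fun measurableSet_Ioi e, setLIntegral_indicator measurableSet_Ici,
            hsub, lintegral_const_mul' _ _ ENNReal.ofReal_ne_top,
            lintegral_Ici_rpow_neg hpq (by positivity), ← ENNReal.ofReal_mul (by positivity),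
            ← ENNReal.ofReal_mul (by positivity), Real.div_rpow hpos.le hb.le]
          congr 1
          rw [show g x ^ q = g x ^ p * g x ^ (-(p - q)) by rw [← Real.rpow_add hpos]; ring_nf,
            show b ^ (p - q) = (b ^ (-(p - q)))⁻¹ by rw [← Real.rpow_neg hb.le]; ring_nf]
          field_simp
    _ = _ := lintegral_const_mul' _ _ ENNReal.ofReal_ne_top

end LayerCake

/-! ### Marcinkiewicz interpolation within the Schwartz class -/

theorem isCompact_le_norm_schwartz (f : 𝓢(N v, ℂ)) {τ : ℝ} (hτ : 0 < τ) :
    IsCompact {n | τ ≤ ‖f n‖} := by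
  have h : ∀ᶠ n in Filter.cocompact (N v), ‖f n‖ < τ := by
    have := (SchwartzMap.tendsto_cocompact f).norm
    rw [norm_zero] at this
    exact this.eventually (gt_mem_nhds hτ)
  obtain ⟨K, hK, hsub⟩ := Filter.mem_cocompact.1 h
  refine hK.of_isClosed_subset (isClosed_le continuous_const f.continuous.norm) fun n hn => ?_
  by_contra hnK
  exact absurd (show τ ≤ ‖f n‖ from hn) (not_le.2 (hsub hnK))

/-- Splitting of a Schwartz function at height `τ` into two Schwartz functions. -/
theorem exists_schwartz_truncation (f : 𝓢(N v, ℂ)) {τ : ℝ} (hτ : 0 < τ) :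
    ∃ f₁ f₂ : 𝓢(N v, ℂ), f = f₁ + f₂ ∧
      (∀ n, ‖f₁ n‖ ≤ ‖f n‖) ∧ (∀ n, ‖f n‖ ≤ τ → f₁ n = 0) ∧
      (∀ n, ‖f₂ n‖ ≤ ‖f n‖) ∧ (∀ n, 2 * τ < ‖f n‖ → f₂ n = 0) := by
  -- The argument goes from `0` at `‖f‖ = τ` to `1` at `‖f‖ = 2τ`; the squared norm keeps it smooth
  -- at the zeros of `f`.
  set χ : N v → ℝ := fun n => Real.smoothTransition ((‖f n‖ ^ 2 / τ ^ 2 - 1) / 3) with hχ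
  have hχsmooth : ContDiff ℝ (⊤ : ℕ∞) χ := by
    have h1 : ContDiff ℝ (⊤ : ℕ∞) fun n => ‖f n‖ ^ 2 := f.smooth'.norm_sq ℝ
    exact Real.smoothTransition.contDiff.comp (((h1.div_const _).sub contDiff_const).div_const _)
  have hχ0 : ∀ n, ‖f n‖ ≤ τ → χ n = 0 := by
    intro n hn
    refine Real.smoothTransition.zero_of_nonpos ?_
    have : ‖f n‖ ^ 2 / τ ^ 2 ≤ 1 := by
      rw [div_le_one (by positivity)]
      exact pow_le_pow_left₀ (norm_nonneg _) hn 2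
    linarith
  have hχ1 : ∀ n, 2 * τ < ‖f n‖ → χ n = 1 := by
    intro n hn
    refine Real.smoothTransition.one_of_one_le ?_
    have : 4 ≤ ‖f n‖ ^ 2 / τ ^ 2 := by
      rw [le_div_iff₀ (by positivity)]
      nlinarith
    linarith
  have hnn : ∀ n, 0 ≤ χ n := fun n => Real.smoothTransition.nonneg _
  have hle : ∀ n, χ n ≤ 1 := fun n => Real.smoothTransition.le_one _
  -- The high part vanishes off the compact set `{τ ≤ ‖f‖}`, so it is Schwartz; the low part is then
  -- Schwartz by subtraction.
  have hsupp : HasCompactSupport fun n => χ n • f n :=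
    HasCompactSupport.intro (isCompact_le_norm_schwartz f hτ) fun n hn => by
      rw [hχ0 n (not_le.1 hn).le, zero_smul]
  set f₁ : 𝓢(N v, ℂ) := hsupp.toSchwartzMap (hχsmooth.smul f.smooth') with hf₁
  have e1 : ∀ n, f₁ n = χ n • f n := fun n => rfl
  have e2 : ∀ n, (f - f₁) n = (1 - χ n) • f n := fun n => by
    rw [sub_apply, e1, sub_smul, one_smul]
  refine ⟨f₁, f - f₁, by simp, fun n => ?_, fun n hn => ?_, fun n => ?_, fun n hn => ?_⟩
  · rw [e1, norm_smul, Real.norm_eq_abs, abs_of_nonneg (hnn n)]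
    exact mul_le_of_le_one_left (norm_nonneg _) (hle n)
  · rw [e1, hχ0 n hn, zero_smul]
  · rw [e2, norm_smul, Real.norm_eq_abs, abs_of_nonneg (sub_nonneg.2 (hle n))]
    exact mul_le_of_le_one_left (norm_nonneg _) (by linarith [hnn n])
  · rw [e2, hχ1 n hn, sub_self, zero_smul]

/-- An operator on Schwartz functions with finite measurable values which is subadditive. -/
structure IsSubadditiveOp (T : 𝓢(N v, ℂ) → N v → ℝ≥0∞) : Prop where
  measurable : ∀ f, Measurable (T f)
  ne_top : ∀ f n, T f n ≠ ∞
  add_le : ∀ f g n, T (f + g) n ≤ T f n + T g n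

/-- Weak type `(p, p)` for an operator on Schwartz functions. -/
def WeakType (T : 𝓢(N v, ℂ) → N v → ℝ≥0∞) (p : ℝ) (κ : ℝ≥0∞) : Prop :=
  ∀ f : 𝓢(N v, ℂ), ∀ t : ℝ, 0 < t → volume {n | ENNReal.ofReal t < T f n} ≤
    κ * (ENNReal.ofReal (t ^ (-p)) * ∫⁻ n, ‖f n‖ₑ ^ p)

/-- Strong type `(p, p)` for an operator on Schwartz functions. -/
def StrongType (T : 𝓢(N v, ℂ) → N v → ℝ≥0∞) (p : ℝ) (κ : ℝ≥0∞) : Prop :=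
  ∀ f : 𝓢(N v, ℂ), ∫⁻ n, T f n ^ p ≤ κ * ∫⁻ n, ‖f n‖ₑ ^ p

theorem enorm_rpow_eq_ofReal (z : ℂ) {p : ℝ} (hp : 0 ≤ p) : ‖z‖ₑ ^ p = ENNReal.ofReal (‖z‖ ^ p) := by
  rw [← ofReal_norm, ENNReal.ofReal_rpow_of_nonneg (norm_nonneg _) hp]

theorem StrongType.weakType {T : 𝓢(N v, ℂ) → N v → ℝ≥0∞} {p : ℝ} {κ : ℝ≥0∞} (hp : 0 < p)
    (hT : ∀ f, Measurable (T f)) (h : StrongType T p κ) : WeakType T p κ := by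
  intro f t ht
  have h1 := mul_meas_ge_le_lintegral (μ := volume) ((hT f).pow_const p) (ENNReal.ofReal t ^ p)
  have h2 : volume {n | ENNReal.ofReal t < T f n} ≤
      volume {n | ENNReal.ofReal t ^ p ≤ T f n ^ p} :=
    measure_mono fun n hn => ENNReal.rpow_le_rpow (le_of_lt hn) hp.le
  have e : ENNReal.ofReal (t ^ (-p)) * ENNReal.ofReal t ^ p = 1 := by
    rw [ENNReal.ofReal_rpow_of_pos ht, ← ENNReal.ofReal_mul (by positivity), ← Real.rpow_add ht]
    simp
  calc _ = ENNReal.ofReal (t ^ (-p)) *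
        (ENNReal.ofReal t ^ p * volume {n | ENNReal.ofReal t < T f n}) := by
        rw [← mul_assoc, e, one_mul]
    _ ≤ ENNReal.ofReal (t ^ (-p)) * (κ * ∫⁻ n, ‖f n‖ₑ ^ p) := by
        exact mul_le_mul_right ((mul_le_mul_right h2 _).trans (h1.trans (h f))) _
    _ = _ := by ring

theorem lintegral_enorm_rpow_le_of_truncation_high {f f₁ : N v → ℂ} {τ p : ℝ} (hp : 0 < p)
    (h1 : ∀ n, ‖f₁ n‖ ≤ ‖f n‖) (h2 : ∀ n, ‖f n‖ ≤ τ → f₁ n = 0) :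
    ∫⁻ n, ‖f₁ n‖ₑ ^ p ≤
      ∫⁻ n, {n | τ < ‖f n‖}.indicator (fun n => ENNReal.ofReal (‖f n‖ ^ p)) n := by
  refine lintegral_mono fun n => ?_
  rw [enorm_rpow_eq_ofReal _ hp.le]
  by_cases h : τ < ‖f n‖
  · rw [indicator_of_mem (show n ∈ {n | τ < ‖f n‖} from h)]
    exact ENNReal.ofReal_le_ofReal (Real.rpow_le_rpow (norm_nonneg _) (h1 n) hp.le)
  · rw [h2 n (not_lt.1 h), norm_zero, Real.zero_rpow hp.ne', ENNReal.ofReal_zero]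
    exact zero_le

theorem lintegral_enorm_rpow_le_of_truncation_low {f f₂ : N v → ℂ} {τ p : ℝ} (hp : 0 < p)
    (h1 : ∀ n, ‖f₂ n‖ ≤ ‖f n‖) (h2 : ∀ n, τ < ‖f n‖ → f₂ n = 0) :
    ∫⁻ n, ‖f₂ n‖ₑ ^ p ≤
      ∫⁻ n, {n | ‖f n‖ ≤ τ}.indicator (fun n => ENNReal.ofReal (‖f n‖ ^ p)) n := by
  refine lintegral_mono fun n => ?_
  rw [enorm_rpow_eq_ofReal _ hp.le]
  by_cases h : ‖f n‖ ≤ τ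
  · rw [indicator_of_mem (show n ∈ {n | ‖f n‖ ≤ τ} from h)]
    exact ENNReal.ofReal_le_ofReal (Real.rpow_le_rpow (norm_nonneg _) (h1 n) hp.le)
  · rw [h2 n (not_le.1 h), norm_zero, Real.zero_rpow hp.ne', ENNReal.ofReal_zero]
    exact zero_le

theorem half_rpow_neg {t : ℝ} (ht : 0 < t) (p : ℝ) :
    ENNReal.ofReal ((t / 2) ^ (-p)) = ENNReal.ofReal (2 ^ p) * ENNReal.ofReal (t ^ (-p)) := by
  rw [← ENNReal.ofReal_mul (by positivity), Real.div_rpow ht.le two_pos.le,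
    Real.rpow_neg two_pos.le, div_inv_eq_mul, mul_comm]

theorem measurable_lintegral_lt {g : N v → ℝ} (hg : Measurable g) (b p : ℝ) :
    Measurable fun t : ℝ =>
      ∫⁻ n, {n | b * t < g n}.indicator (fun n => ENNReal.ofReal (g n ^ p)) n := by
  have h2 : Measurable fun z : ℝ × N v => {z : ℝ × N v | b * z.1 < g z.2}.indicator
      (fun z => ENNReal.ofReal (g z.2 ^ p)) z :=
    ((hg.comp measurable_snd).pow_const _).ennreal_ofReal.indicator
      (measurableSet_lt (measurable_fst.const_mul b) (hg.comp measurable_snd))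
  exact h2.lintegral_prod_right'

/-- Marcinkiewicz interpolation between two weak type estimates, for operators defined only on
Schwartz functions; the parameter `b` is the height at which functions are cut. -/
theorem WeakType.strongType_of_weakType {T : 𝓢(N v, ℂ) → N v → ℝ≥0∞} (hT : IsSubadditiveOp T)
    {p₁ p₂ q b : ℝ} {κ₁ κ₂ : ℝ≥0∞} (h₁ : WeakType T p₁ κ₁) (h₂ : WeakType T p₂ κ₂) (hp₁ : 0 < p₁)
    (hq₁ : p₁ < q) (hq₂ : q < p₂) (hb : 0 < b) (hκ₁ : κ₁ ≠ ∞) (hκ₂ : κ₂ ≠ ∞) :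
    StrongType T q (ENNReal.ofReal q *
      (κ₁ * ENNReal.ofReal (2 ^ p₁) * ENNReal.ofReal (b ^ (p₁ - q) / (q - p₁)) +
        κ₂ * ENNReal.ofReal (2 ^ p₂) * ENNReal.ofReal ((2 * b) ^ (p₂ - q) / (p₂ - q)))) := by
  intro f
  have hq : 0 < q := hp₁.trans hq₁
  set g : N v → ℝ := fun n => ‖f n‖ with hg
  have hgm : Measurable g := f.continuous.norm.measurable
  have hlevel : ∀ t : ℝ, 0 < t → volume {n | ENNReal.ofReal t < T f n} ≤
      κ₁ * ENNReal.ofReal (2 ^ p₁) * (ENNReal.ofReal (t ^ (-p₁)) *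
        ∫⁻ n, {n | b * t < g n}.indicator (fun n => ENNReal.ofReal (g n ^ p₁)) n) +
      κ₂ * ENNReal.ofReal (2 ^ p₂) * (ENNReal.ofReal (t ^ (-p₂)) *
        ∫⁻ n, {n | g n ≤ 2 * b * t}.indicator (fun n => ENNReal.ofReal (g n ^ p₂)) n) := by
    intro t ht
    -- Where `T f > t`, one of the two pieces has image above `t / 2`: the high piece is estimated
    -- at exponent `p₁`, the low one at `p₂`.
    obtain ⟨f₁, f₂, hf, h11, h12, h21, h22⟩ := exists_schwartz_truncation f (mul_pos hb ht)
    have hsub : {n | ENNReal.ofReal t < T f n} ⊆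
        {n | ENNReal.ofReal (t / 2) < T f₁ n} ∪ {n | ENNReal.ofReal (t / 2) < T f₂ n} := by
      intro n hn
      by_contra hcon
      simp only [mem_union, mem_ofPred_eq, not_or, not_lt] at hcon
      have h3 := hT.add_le f₁ f₂ n
      rw [← hf] at h3
      have h4 : T f n ≤ ENNReal.ofReal t := by
        refine h3.trans ((add_le_add hcon.1 hcon.2).trans_eq ?_)
        rw [← ENNReal.ofReal_add (by positivity) (by positivity), add_halves]
      exact absurd hn (not_lt.2 h4)
    refine (measure_mono hsub).trans ((measure_union_le _ _).trans (add_le_add ?_ ?_))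
    · refine (h₁ f₁ (t / 2) (by positivity)).trans ?_
      rw [half_rpow_neg ht, mul_assoc, mul_assoc]
      exact mul_le_mul_right (mul_le_mul_right (mul_le_mul_right
        (lintegral_enorm_rpow_le_of_truncation_high hp₁ h11 h12) _) _) _
    · refine (h₂ f₂ (t / 2) (by positivity)).trans ?_
      rw [half_rpow_neg ht, mul_assoc, mul_assoc]
      refine mul_le_mul_right (mul_le_mul_right (mul_le_mul_right
        (lintegral_enorm_rpow_le_of_truncation_low (hq.trans hq₂) h21 ?_) _) _) _
      intro n hn
      exact h22 n (by rwa [← mul_assoc])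
  rw [lintegral_rpow_eq_of_ne_top (hT.measurable f) (hT.ne_top f) hq, mul_assoc]
  gcongr
  calc ∫⁻ t in Ioi (0 : ℝ), volume {n | ENNReal.ofReal t < T f n} * ENNReal.ofReal (t ^ (q - 1))
      ≤ ∫⁻ t in Ioi (0 : ℝ), (κ₁ * ENNReal.ofReal (2 ^ p₁) * (ENNReal.ofReal (t ^ (-p₁)) *
        (∫⁻ n, {n | b * t < g n}.indicator (fun n => ENNReal.ofReal (g n ^ p₁)) n) *
          ENNReal.ofReal (t ^ (q - 1))) +
        κ₂ * ENNReal.ofReal (2 ^ p₂) * (ENNReal.ofReal (t ^ (-p₂)) *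
        (∫⁻ n, {n | g n ≤ 2 * b * t}.indicator (fun n => ENNReal.ofReal (g n ^ p₂)) n) *
          ENNReal.ofReal (t ^ (q - 1)))) := by
        refine setLIntegral_mono' measurableSet_Ioi fun t ht => ?_
        refine (mul_le_mul_left (hlevel t ht) _).trans_eq ?_
        ring
    _ = _ := by
        have hm : Measurable fun t : ℝ => κ₁ * ENNReal.ofReal (2 ^ p₁) *
          (ENNReal.ofReal (t ^ (-p₁)) *
          (∫⁻ n, {n | b * t < g n}.indicator (fun n => ENNReal.ofReal (g n ^ p₁)) n) *
          ENNReal.ofReal (t ^ (q - 1))) :=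
          ((((measurable_id.pow_const _).ennreal_ofReal).mul
            (measurable_lintegral_lt hgm b p₁)).mul
            (measurable_id.pow_const _).ennreal_ofReal).const_mul _
        rw [lintegral_add_left hm,
          lintegral_const_mul' _ _ (ENNReal.mul_ne_top hκ₁ ENNReal.ofReal_ne_top),
          lintegral_const_mul' _ _ (ENNReal.mul_ne_top hκ₂ ENNReal.ofReal_ne_top),
          lintegral_rpow_mul_lintegral_lt hgm (fun _ => norm_nonneg _) hp₁ hq₁ hb,
          lintegral_rpow_mul_lintegral_le hgm (fun _ => norm_nonneg _) hq hq₂ (by positivity)]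
        simp only [enorm_rpow_eq_ofReal _ hq.le]
        ring

/-- Marcinkiewicz interpolation between a weak type estimate and an `L^∞` estimate, for operators
defined only on Schwartz functions. -/
theorem WeakType.strongType_of_bounded {T : 𝓢(N v, ℂ) → N v → ℝ≥0∞} (hT : IsSubadditiveOp T)
    {p q B : ℝ} {κ : ℝ≥0∞} (h : WeakType T p κ) (hp : 0 < p) (hq : p < q) (hB : 0 < B)
    (hκ : κ ≠ ∞)
    (hbdd : ∀ (f : 𝓢(N v, ℂ)) (M : ℝ), (∀ n, ‖f n‖ ≤ M) → ∀ n, T f n ≤ ENNReal.ofReal (B * M)) :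
    ∃ C : ℝ≥0∞, C ≠ ∞ ∧ StrongType T q C := by
  refine ⟨ENNReal.ofReal q *
    (κ * ENNReal.ofReal (2 ^ p) * ENNReal.ofReal ((4 * B)⁻¹ ^ (p - q) / (q - p))), ?_, fun f => ?_⟩
  · exact ENNReal.mul_ne_top ENNReal.ofReal_ne_top (ENNReal.mul_ne_top
      (ENNReal.mul_ne_top hκ ENNReal.ofReal_ne_top) ENNReal.ofReal_ne_top)
  have hq0 : 0 < q := hp.trans hq
  -- With this height the low piece is at most `2 b t = t / (2B)`, so its image is at most `t / 2`
  -- and only the high piece contributes.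
  set b : ℝ := (4 * B)⁻¹ with hb
  have hb0 : 0 < b := by positivity
  set g : N v → ℝ := fun n => ‖f n‖ with hg
  have hgm : Measurable g := f.continuous.norm.measurable
  have hlevel : ∀ t : ℝ, 0 < t → volume {n | ENNReal.ofReal t < T f n} ≤
      κ * ENNReal.ofReal (2 ^ p) * (ENNReal.ofReal (t ^ (-p)) *
        ∫⁻ n, {n | b * t < g n}.indicator (fun n => ENNReal.ofReal (g n ^ p)) n) := by
    intro t ht
    obtain ⟨f₁, f₂, hf, h11, h12, h21, h22⟩ := exists_schwartz_truncation f (mul_pos hb0 ht)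
    have h2 : ∀ n, T f₂ n ≤ ENNReal.ofReal (t / 2) := by
      have hle : ∀ n, ‖f₂ n‖ ≤ 2 * (b * t) := by
        intro n
        by_cases hn : 2 * (b * t) < ‖f n‖
        · rw [h22 n hn, norm_zero]
          positivity
        · exact (h21 n).trans (not_lt.1 hn)
      intro n
      refine (hbdd f₂ _ hle n).trans_eq ?_
      congr 1
      rw [hb]
      field_simp
      ring
    have hsub : {n | ENNReal.ofReal t < T f n} ⊆ {n | ENNReal.ofReal (t / 2) < T f₁ n} := by
      intro n hn
      by_contra hcon
      have h3 := hT.add_le f₁ f₂ n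
      rw [← hf] at h3
      have h4 : T f n ≤ ENNReal.ofReal t := by
        refine h3.trans ((add_le_add (not_lt.1 hcon) (h2 n)).trans_eq ?_)
        rw [← ENNReal.ofReal_add (by positivity) (by positivity), add_halves]
      exact absurd hn (not_lt.2 h4)
    refine (measure_mono hsub).trans ((h f₁ (t / 2) (by positivity)).trans ?_)
    rw [half_rpow_neg ht, mul_assoc, mul_assoc]
    exact mul_le_mul_right (mul_le_mul_right (mul_le_mul_right
      (lintegral_enorm_rpow_le_of_truncation_high hp h11 h12) _) _) _
  rw [lintegral_rpow_eq_of_ne_top (hT.measurable f) (hT.ne_top f) hq0, mul_assoc]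
  gcongr
  calc ∫⁻ t in Ioi (0 : ℝ), volume {n | ENNReal.ofReal t < T f n} * ENNReal.ofReal (t ^ (q - 1))
      ≤ ∫⁻ t in Ioi (0 : ℝ), (κ * ENNReal.ofReal (2 ^ p) * (ENNReal.ofReal (t ^ (-p)) *
        (∫⁻ n, {n | b * t < g n}.indicator (fun n => ENNReal.ofReal (g n ^ p)) n) *
          ENNReal.ofReal (t ^ (q - 1)))) := by
        refine setLIntegral_mono' measurableSet_Ioi fun t ht => ?_
        refine (mul_le_mul_left (hlevel t ht) _).trans_eq ?_
        ring
    _ = _ := by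
        rw [lintegral_const_mul' _ _ (ENNReal.mul_ne_top hκ ENNReal.ofReal_ne_top),
          lintegral_rpow_mul_lintegral_lt hgm (fun _ => norm_nonneg _) hp hq hb0]
        simp only [enorm_rpow_eq_ofReal _ hq0.le]
        ring

/-! ### Smooth dependence of integrals on a parameter -/

section ParametricIntegral

variable {X : Type*} [MeasurableSpace X]

theorem integrable_of_continuous_of_ae_mem_compact [TopologicalSpace X]
    [SecondCountableTopology X] [OpensMeasurableSpace X] {μ : Measure X} [IsFiniteMeasure μ]
    {K : Set X} (hK : IsCompact K) (hμ : ∀ᵐ x ∂μ, x ∈ K) {g : X → ℂ} (hg : Continuous g) :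
    Integrable g μ := by
  obtain ⟨C, hC⟩ := hK.exists_bound_of_continuousOn hg.continuousOn
  exact Integrable.of_bound hg.aestronglyMeasurable C (hμ.mono fun x hx => hC x hx)

/-- A finite measure carried by a compact set admits a constant dominating function: the maximum of
the derivative over that set and a unit neighbourhood of `s`. -/
theorem hasDerivAt_integral_of_ae_mem_compact [TopologicalSpace X] [SecondCountableTopology X]
    [OpensMeasurableSpace X] {μ : Measure X} [IsFiniteMeasure μ] {K : Set X} (hK : IsCompact K)
    (hμ : ∀ᵐ x ∂μ, x ∈ K) {G G' : ℝ → X → ℂ} (hG : ∀ s, Continuous (G s))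
    (hG' : Continuous fun q : ℝ × X => G' q.1 q.2)
    (hd : ∀ s x, HasDerivAt (fun s => G s x) (G' s x) s) (s : ℝ) :
    HasDerivAt (fun s => ∫ x, G s x ∂μ) (∫ x, G' s x ∂μ) s := by
  obtain ⟨C, hC⟩ := ((isCompact_closedBall s 1).prod hK).exists_bound_of_continuousOn
    hG'.continuousOn
  refine (hasDerivAt_integral_of_dominated_loc_of_deriv_le (bound := fun _ => C)
    (Metric.closedBall_mem_nhds s one_pos)
    (Filter.Eventually.of_forall fun s => (hG s).aestronglyMeasurable)
    (integrable_of_continuous_of_ae_mem_compact hK hμ (hG s))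
    (hG'.comp (Continuous.prodMk_right s)).aestronglyMeasurable ?_ (integrable_const C) ?_).2
  · exact hμ.mono fun x hx t ht => hC (t, x) ⟨ht, hx⟩
  · exact Filter.Eventually.of_forall fun x t _ => hd t x

/-- Induction on the order of differentiability for all integrands at once, since the derivative is
an integral of the same type with integrand `∂H/∂s`. -/
theorem contDiff_integral_of_ae_mem_compact [NormedAddCommGroup X] [NormedSpace ℝ X]
    [SecondCountableTopology X] [OpensMeasurableSpace X] {μ : Measure X} [IsFiniteMeasure μ]
    {K : Set X} (hK : IsCompact K) (hμ : ∀ᵐ x ∂μ, x ∈ K) {H : ℝ × X → ℂ}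
    (hH : ContDiff ℝ (⊤ : ℕ∞) H) : ContDiff ℝ (⊤ : ℕ∞) fun s => ∫ x, H (s, x) ∂μ := by
  refine contDiff_infty.2 fun k => ?_
  induction k generalizing H with
  | zero =>
    refine contDiff_zero.2 (continuous_iff_continuousAt.2 fun s => ?_)
    obtain ⟨C, hC⟩ := ((isCompact_closedBall s 1).prod hK).exists_bound_of_continuousOn
      hH.continuous.continuousOn
    refine continuousAt_of_dominated (bound := fun _ => C)
      (Filter.Eventually.of_forall fun s =>
        (hH.continuous.comp (Continuous.prodMk_right s)).aestronglyMeasurable)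
      ?_ (integrable_const C) (Filter.Eventually.of_forall fun x =>
        (hH.continuous.comp (Continuous.prodMk_left x)).continuousAt)
    filter_upwards [Metric.closedBall_mem_nhds s one_pos] with t ht
    exact hμ.mono fun x hx => hC (t, x) ⟨ht, hx⟩
  | succ k ih =>
    have hH' : ContDiff ℝ (⊤ : ℕ∞) fun q => fderiv ℝ H q (1, 0) :=
      (hH.fderiv_right (m := (⊤ : ℕ∞)) (by simp)).clm_apply contDiff_const
    have hd : ∀ s, HasDerivAt (fun s => ∫ x, H (s, x) ∂μ)
        (∫ x, fderiv ℝ H (s, x) (1, 0) ∂μ) s := by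
      intro s
      refine hasDerivAt_integral_of_ae_mem_compact (G' := fun s x => fderiv ℝ H (s, x) (1, 0)) hK hμ
        (fun s => hH.continuous.comp (Continuous.prodMk_right s)) hH'.continuous ?_ s
      intro s x
      have h1 : HasFDerivAt H (fderiv ℝ H (s, x)) (s, x) :=
        ((hH.differentiable (by simp)) (s, x)).hasFDerivAt
      exact h1.comp_hasDerivAt s ((hasDerivAt_id s).prodMk (hasDerivAt_const s x))
    have hderiv : deriv (fun s => ∫ x, H (s, x) ∂μ) = fun s => ∫ x, fderiv ℝ H (s, x) (1, 0) ∂μ :=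
      funext fun s => (hd s).deriv
    push_cast
    refine contDiff_succ_iff_deriv.2 ⟨fun s => (hd s).differentiableAt, by simp, ?_⟩
    rw [hderiv]
    exact ih hH'

end ParametricIntegral

/-! ### Bump profiles and radial averages -/

/-- A smooth bump function supported in `[5/4, 7/4]`. -/
noncomputable def bump : ContDiffBump (3 / 2 : ℝ) := ⟨1 / 8, 1 / 4, by norm_num, by norm_num⟩

theorem contDiff_bump : ContDiff ℝ (⊤ : ℕ∞) bump := bump.contDiff

theorem contDiff_iteratedDeriv {E : Type*} [NormedAddCommGroup E] [NormedSpace ℝ E] {g : ℝ → E}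
    (hg : ContDiff ℝ (⊤ : ℕ∞) g) (k : ℕ) : ContDiff ℝ (⊤ : ℕ∞) (iteratedDeriv k g) :=
  iteratedDeriv_eq_iterate (f := g) ▸ hg.iterate_deriv k

theorem hasDerivAt_iteratedDeriv {E : Type*} [NormedAddCommGroup E] [NormedSpace ℝ E] {g : ℝ → E}
    (hg : ContDiff ℝ (⊤ : ℕ∞) g) (k : ℕ) (u : ℝ) :
    HasDerivAt (iteratedDeriv k g) (iteratedDeriv (k + 1) g u) u := by
  rw [iteratedDeriv_succ]
  exact ((contDiff_iteratedDeriv hg k).differentiable (by simp) u).hasDerivAt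

theorem iteratedDeriv_bump_eq_zero (k : ℕ) {u : ℝ} (hu : u ∉ Ioo (1 : ℝ) 2) :
    iteratedDeriv k bump u = 0 := by
  have h : (bump : ℝ → ℝ) =ᶠ[nhds u] fun _ => 0 := by
    have : {w : ℝ | 1 / 4 < dist w (3 / 2)} ∈ nhds u := by
      refine (isOpen_lt continuous_const (continuous_id.dist continuous_const)).mem_nhds ?_
      change 1 / 4 < |u - 3 / 2|
      rw [lt_abs]
      by_contra! hcon
      exact hu ⟨by linarith, by linarith⟩
    filter_upwards [this] with w hw
    exact bump.zero_of_le_dist (le_of_lt hw)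
  rw [h.iteratedDeriv_eq k]
  simp

/-- Integration by parts `k` times. The bump vanishes near `1` and `2`, so there are no boundary
terms, and each derivative moved to `F` costs `-β`. -/
theorem integral_iteratedDeriv_bump_smul {F : ℝ → ℂ} (hF : ContDiff ℝ (⊤ : ℕ∞) F) (α β : ℝ)
    (k j : ℕ) :
    ∫ u in (1 : ℝ)..2, iteratedDeriv k bump u • iteratedDeriv j F (α + β * u) =
      (-β) ^ k • ∫ u in (1 : ℝ)..2, bump u • iteratedDeriv (j + k) F (α + β * u) := by
  induction k generalizing j with
  | zero => simp
  | succ k ih =>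
    have hv : ∀ u ∈ uIcc (1 : ℝ) 2, HasDerivAt (fun u => iteratedDeriv j F (α + β * u))
        (β • iteratedDeriv (j + 1) F (α + β * u)) u := by
      intro u _
      have h1 : HasDerivAt (fun u => α + β * u) β u := by
        simpa using ((hasDerivAt_id u).const_mul β).const_add α
      exact (hasDerivAt_iteratedDeriv hF j (α + β * u)).scomp u h1
    have hc : ∀ i, Continuous fun u => iteratedDeriv i F (α + β * u) := fun i =>
      (contDiff_iteratedDeriv hF i).continuous.comp (by fun_prop)
    have hparts := intervalIntegral.integral_smul_deriv_eq_deriv_smul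
      (fun u _ => hasDerivAt_iteratedDeriv contDiff_bump k u) hv
      ((contDiff_iteratedDeriv contDiff_bump (k + 1)).continuous.intervalIntegrable _ _)
      (((hc (j + 1)).const_smul β).intervalIntegrable _ _)
    rw [iteratedDeriv_bump_eq_zero k (by simp), iteratedDeriv_bump_eq_zero k (by simp), zero_smul,
      zero_smul, sub_zero, zero_sub] at hparts
    rw [eq_neg_iff_add_eq_zero, add_comm, ← eq_neg_iff_add_eq_zero] at hparts
    rw [hparts]
    simp_rw [smul_comm _ β]
    rw [intervalIntegral.integral_smul, ih (j + 1), ← neg_smul, smul_smul, pow_succ', add_assoc,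
      add_comm 1 k]

/-- Each integration by parts moves a derivative onto the negative power, and its minus sign cancels
that of `(u^(-m-1))' = -(m+1) u^(-m-2)`. After `k` steps the integrand is a positive multiple of the
bump times a negative power; `m` is free because the exponent changes. -/
theorem integral_iteratedDeriv_bump_mul_inv_pos (k m : ℕ) :
    0 < ∫ u in (1 : ℝ)..2, iteratedDeriv k bump u * (u ^ (m + 1))⁻¹ := by
  induction k generalizing m with
  | zero =>
    simp only [iteratedDeriv_zero]
    have h := intervalIntegral.integral_lt_integral_of_continuousOn_of_le_of_exists_lt
      (f := fun _ => 0) (g := fun u : ℝ => bump u * (u ^ (m + 1))⁻¹) one_lt_two continuousOn_const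
      (contDiff_bump.continuous.continuousOn.mul ((continuousOn_id.pow _).inv₀ fun u hu =>
        pow_ne_zero _ (zero_lt_one.trans_le hu.1).ne'))
      (fun u hu => mul_nonneg bump.nonneg (inv_nonneg.2 (pow_nonneg (by linarith [hu.1]) _)))
      ⟨3 / 2, by norm_num, mul_pos (bump.pos_of_mem_ball (by simp [bump])) (by positivity)⟩
    simpa using h
  | succ k ih =>
    have hu : ∀ x ∈ uIcc (1 : ℝ) 2, HasDerivAt (fun u : ℝ => (u ^ (m + 1))⁻¹)
        (-((m + 1 : ℕ) : ℝ) * (x ^ (m + 2))⁻¹) x := by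
      intro x hx
      rw [uIcc_of_le one_le_two] at hx
      have hx0 : x ≠ 0 := (zero_lt_one.trans_le hx.1).ne'
      refine ((hasDerivAt_pow (m + 1) x).fun_inv (pow_ne_zero _ hx0)).congr_deriv ?_
      rw [Nat.add_sub_cancel]
      field_simp
      ring
    have hcont : ContinuousOn (fun x : ℝ => -((m + 1 : ℕ) : ℝ) * (x ^ (m + 2))⁻¹)
        (uIcc (1 : ℝ) 2) := by
      rw [uIcc_of_le one_le_two]
      exact continuousOn_const.mul ((continuousOn_id.pow _).inv₀ fun u hu =>
        pow_ne_zero _ (zero_lt_one.trans_le hu.1).ne')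
    have hparts := intervalIntegral.integral_mul_deriv_eq_deriv_mul hu
      (fun u _ => hasDerivAt_iteratedDeriv contDiff_bump k u) hcont.intervalIntegrable
      ((contDiff_iteratedDeriv contDiff_bump (k + 1)).continuous.intervalIntegrable _ _)
    rw [iteratedDeriv_bump_eq_zero k (by simp), iteratedDeriv_bump_eq_zero k (by simp), mul_zero,
      mul_zero, sub_zero, zero_sub] at hparts
    simp_rw [mul_assoc, intervalIntegral.integral_const_mul, neg_mul, neg_neg] at hparts
    simp_rw [mul_comm (iteratedDeriv _ _ _)]
    rw [hparts]
    have := ih (m + 1)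
    simp_rw [mul_comm (iteratedDeriv _ _ _)] at this
    positivity

/-- The profile of the radial averages: on `[1, 2]` it is the `k`-th derivative of the bump divided
by the variable. -/
noncomputable def profile (k : ℕ) (u : ℝ) : ℝ := iteratedDeriv k bump u / max u 1

/-- The `max` in the denominator gives continuity on the whole line without changing the profile on
`[1, 2]`. -/
theorem continuous_profile (k : ℕ) : Continuous (profile k) :=
  (contDiff_iteratedDeriv contDiff_bump k).continuous.div (by fun_prop) fun u =>
    (zero_lt_one.trans_le (le_max_right u 1)).ne'

theorem profile_mul {u : ℝ} (k : ℕ) (hu : 1 ≤ u) : profile k u * u = iteratedDeriv k bump u := by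
  rw [profile, max_eq_left hu, div_mul_cancel₀ _ (by positivity)]

/-- The integral of the profile over `[1, 2]`. -/
noncomputable def profileMass (k : ℕ) : ℝ := ∫ u in (1 : ℝ)..2, profile k u

theorem profileMass_pos (k : ℕ) : 0 < profileMass k := by
  have h := integral_iteratedDeriv_bump_mul_inv_pos k 0
  rw [profileMass]
  convert h using 1
  refine intervalIntegral.integral_congr fun u hu => ?_
  rw [uIcc_of_le one_le_two] at hu
  simp [profile, max_eq_left hu.1, div_eq_mul_inv]

/-- The average of `F` over radii in `[r + rε, r + 2rε]` against the `k`-th profile. -/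
noncomputable def radialAvg (k : ℕ) (F : ℝ → ℂ) (r ε : ℝ) : ℂ :=
  ∫ u in (1 : ℝ)..2, profile k u • F (r + r * ε * u)

theorem radialAvg_zero (k : ℕ) (F : ℝ → ℂ) (r : ℝ) : radialAvg k F r 0 = profileMass k • F r := by
  simp only [radialAvg, profileMass, mul_zero, zero_mul, add_zero]
  exact intervalIntegral.integral_smul_const _ _

/-- The factor `r u` from the chain rule cancels the denominator of the profile, leaving the `k`-th
derivative of the bump against `F'`. Integration by parts then trades it for a gain `(rε)^k` and `k`
further derivatives of `F`. -/
theorem hasDerivAt_radialAvg {F : ℝ → ℂ} (hF : ContDiff ℝ (⊤ : ℕ∞) F) (k : ℕ) (r ε : ℝ) :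
    HasDerivAt (radialAvg k F r)
      ((r * (-(r * ε)) ^ k) • ∫ u in (1 : ℝ)..2, bump u • iteratedDeriv (k + 1) F (r + r * ε * u))
      ε := by
  have hae : ∀ᵐ u ∂(volume.restrict (Ioc (1 : ℝ) 2)), u ∈ Icc (1 : ℝ) 2 := by
    filter_upwards [ae_restrict_mem measurableSet_Ioc] with u hu using Ioc_subset_Icc_self hu
  have hF' : Continuous (deriv F) := by
    have := (contDiff_iteratedDeriv hF 1).continuous
    rwa [iteratedDeriv_one] at this
  have hcp := continuous_profile k
  have h := hasDerivAt_integral_of_ae_mem_compact (isCompact_Icc (a := (1 : ℝ)) (b := 2)) hae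
    (G := fun ε u => profile k u • F (r + r * ε * u))
    (G' := fun ε u => profile k u • ((r * u) • deriv F (r + r * ε * u)))
    (fun ε => hcp.smul (hF.continuous.comp (by fun_prop)))
    (by fun_prop) (by
      intro ε u
      have h1 : HasDerivAt (fun ε => r + r * ε * u) (r * u) ε := by
        simpa using (((hasDerivAt_id ε).const_mul r).mul_const u).const_add r
      have h2 := ((hF.differentiable (by simp)) (r + r * ε * u)).hasDerivAt.scomp ε h1
      exact h2.const_smul (profile k u))
    ε
  have e1 : radialAvg k F r = fun ε => ∫ u in Ioc (1 : ℝ) 2, profile k u • F (r + r * ε * u) :=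
    funext fun ε => intervalIntegral.integral_of_le one_le_two
  have e2 := integral_iteratedDeriv_bump_smul hF r (r * ε) k 1
  rw [e1, mul_smul, add_comm k 1, ← e2, ← intervalIntegral.integral_smul,
    intervalIntegral.integral_of_le one_le_two]
  convert h using 1
  refine setIntegral_congr_fun measurableSet_Ioc fun u hu => ?_
  simp only [iteratedDeriv_one]
  rw [← profile_mul k hu.1.le, smul_smul, smul_smul]
  congr 1
  ring

/-! ### Spherical means and suprema over radii -/

/-- The spherical mean of `f` over the Korányi sphere of radius `s` centred at `n`. -/
noncomputable def sphMean (f : N v → ℂ) (n : N v) (s : ℝ) : ℂ :=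
  ∫ m, f (n * (dil s m)⁻¹) ∂(sphereMeasure v)

theorem contDiff_translate_dil (n : N v) :
    ContDiff ℝ (⊤ : ℕ∞) fun q : ℝ × N v => n * (dil q.1 q.2)⁻¹ :=
  ((contDiff_mul.comp (contDiff_const.prodMk contDiff_dil.neg)).of_le le_top)

theorem continuous_translate_dil :
    Continuous fun q : (N v × ℝ) × N v => q.1.1 * (dil q.1.2 q.2)⁻¹ := by
  have h : Continuous fun q : (N v × ℝ) × N v => dil q.1.2 q.2 :=
    contDiff_dil.continuous.comp
      ((continuous_snd.comp continuous_fst).prodMk continuous_snd)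
  exact (continuous_fst.comp continuous_fst).mul h.inv

theorem conv_dilMeasure {f : N v → ℂ} (hf : Continuous f) (n : N v) (s : ℝ) :
    conv (dilMeasure s (sphereMeasure v)) f n = sphMean f n s := by
  have h : Measurable (dil s : N v → N v) := measurable_dil.comp measurable_prodMk_left
  have hc : Continuous fun m : N v => f (n * m⁻¹) :=
    hf.comp (continuous_const.mul continuous_inv)
  exact integral_map h.aemeasurable hc.aestronglyMeasurable

theorem dilOp_conv {r : ℝ} (hr : 0 < r) (f : N v → ℂ) (n : N v) :
    dilOp r (conv (sphereMeasure v)) f n = sphMean f n r := by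
  simp only [dilOp, conv, sphMean, dil_mul, dil_inv, dil_dil, mul_inv_cancel₀ hr.ne', dil_one]

theorem sphericalMaximal_eq (f : N v → ℂ) (n : N v) :
    sphericalMaximal v f n = ⨆ r ∈ Ioi (0 : ℝ), ‖sphMean f n r‖ₑ := by
  simp only [sphericalMaximal, maximalFunction]
  exact iSup_congr fun r => iSup_congr fun hr => by rw [dilOp_conv hr]

theorem squareFunction_eq {f : N v → ℂ} (hf : Continuous f) (j : ℕ) (n : N v) :
    squareFunction v j f n = (∫⁻ s in Ioi (0 : ℝ), ‖iteratedDeriv j (sphMean f n) s‖ₑ ^ 2 *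
      ENNReal.ofReal (s ^ (2 * j - 1))) ^ (1 / 2 : ℝ) := by
  have : (fun t : ℝ => conv (dilMeasure t (sphereMeasure v)) f n) = sphMean f n :=
    funext fun t => conv_dilMeasure hf n t
  rw [squareFunction, this]

theorem isCompact_closure_box (r : ℝ) : IsCompact (closure (box v r)) :=
  (isBounded_box r).isCompact_closure

theorem ae_sphereMeasure_mem_closure (hv : 1 ≤ v) :
    ∀ᵐ m ∂(sphereMeasure v), m ∈ closure (box v 1) :=
  (ae_sphereMeasure_mem_box hv).mono fun _ hm => subset_closure hm

theorem contDiff_sphMean (hv : 1 ≤ v) (f : 𝓢(N v, ℂ)) (n : N v) :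
    ContDiff ℝ (⊤ : ℕ∞) (sphMean f n) :=
  contDiff_integral_of_ae_mem_compact (isCompact_closure_box 1) (ae_sphereMeasure_mem_closure hv)
    (H := fun q => f (n * (dil q.1 q.2)⁻¹)) (f.smooth'.comp (contDiff_translate_dil n))

theorem exists_schwartz_norm_le (f : 𝓢(N v, ℂ)) : ∃ M : ℝ, 0 ≤ M ∧ ∀ n, ‖f n‖ ≤ M :=
  ⟨SchwartzMap.seminorm ℝ 0 0 f, apply_nonneg _ _, fun n => SchwartzMap.norm_le_seminorm ℝ f n⟩

theorem continuous_sphMean (f : 𝓢(N v, ℂ)) :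
    Continuous fun q : N v × ℝ => sphMean f q.1 q.2 := by
  obtain ⟨M, _, hM⟩ := exists_schwartz_norm_le f
  have hc : Continuous fun q : (N v × ℝ) × N v => f (q.1.1 * (dil q.1.2 q.2)⁻¹) :=
    f.continuous.comp continuous_translate_dil
  exact continuous_of_dominated (bound := fun _ => M)
    (fun q => (hc.comp (Continuous.prodMk_right q)).aestronglyMeasurable)
    (fun q => Filter.Eventually.of_forall fun m => hM _) (integrable_const M)
    (Filter.Eventually.of_forall fun m => hc.comp (Continuous.prodMk_left m))

theorem sphMean_add (f g : 𝓢(N v, ℂ)) (n : N v) (s : ℝ) :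
    sphMean (f + g) n s = sphMean f n s + sphMean g n s := by
  have hi : ∀ f : 𝓢(N v, ℂ),
      Integrable (fun m => f (n * (dil s m)⁻¹)) (sphereMeasure v) := by
    intro f
    obtain ⟨M, _, hM⟩ := exists_schwartz_norm_le f
    have hc : Continuous fun m : N v => f (n * (dil s m)⁻¹) :=
      f.continuous.comp (continuous_translate_dil.comp (Continuous.prodMk_right (n, s)))
    exact Integrable.of_bound hc.aestronglyMeasurable M (Filter.Eventually.of_forall fun m => hM _)
  exact integral_add (hi f) (hi g)

theorem norm_sphMean_le {f : N v → ℂ} {M : ℝ} (hM : ∀ n, ‖f n‖ ≤ M) (n : N v) (s : ℝ) :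
    ‖sphMean f n s‖ ≤ (sphereMeasure v).real univ * M := by
  rw [mul_comm]
  exact norm_integral_le_of_norm_le_const (Filter.Eventually.of_forall fun m => hM _)

/-- A family of bounded additive operators, indexed by a radius, from Schwartz functions to
continuous functions. -/
structure IsRadialFamily (L : 𝓢(N v, ℂ) → N v → ℝ → ℂ) (B : ℝ) : Prop where
  add : ∀ f g n r, L (f + g) n r = L f n r + L g n r
  continuous : ∀ f r, Continuous fun n => L f n r
  bound : ∀ f M, (∀ n, ‖f n‖ ≤ M) → ∀ n r, ‖L f n r‖ ≤ B * M

/-- The maximal operator of a family of operators indexed by a radius. -/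
noncomputable def radialSup (L : 𝓢(N v, ℂ) → N v → ℝ → ℂ) (f : 𝓢(N v, ℂ)) (n : N v) : ℝ≥0∞ :=
  ⨆ r ∈ Ioi (0 : ℝ), ‖L f n r‖ₑ

theorem radialSup_le_iff {L : 𝓢(N v, ℂ) → N v → ℝ → ℂ} {f : 𝓢(N v, ℂ)} {n : N v} {c : ℝ≥0∞} :
    radialSup L f n ≤ c ↔ ∀ r, 0 < r → ‖L f n r‖ₑ ≤ c :=
  iSup₂_le_iff

theorem le_radialSup (L : 𝓢(N v, ℂ) → N v → ℝ → ℂ) (f : 𝓢(N v, ℂ)) (n : N v) {r : ℝ}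
    (hr : 0 < r) : ‖L f n r‖ₑ ≤ radialSup L f n :=
  radialSup_le_iff.1 le_rfl r hr

theorem IsRadialFamily.radialSup_le {L : 𝓢(N v, ℂ) → N v → ℝ → ℂ} {B : ℝ}
    (hL : IsRadialFamily L B) (f : 𝓢(N v, ℂ)) (M : ℝ) (hM : ∀ n, ‖f n‖ ≤ M) (n : N v) :
    radialSup L f n ≤ ENNReal.ofReal (B * M) :=
  radialSup_le_iff.2 fun r _ => by
    rw [← ofReal_norm]
    exact ENNReal.ofReal_le_ofReal (hL.bound f M hM n r)

theorem IsRadialFamily.isSubadditiveOp {L : 𝓢(N v, ℂ) → N v → ℝ → ℂ} {B : ℝ}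
    (hL : IsRadialFamily L B) : IsSubadditiveOp (radialSup L) where
  measurable f := by
    -- The supremum is uncountable, but as a supremum of continuous functions it is lower
    -- semicontinuous.
    have : LowerSemicontinuous (radialSup L f) :=
      lowerSemicontinuous_iSup fun r => lowerSemicontinuous_iSup fun _ =>
        (hL.continuous f r).enorm.lowerSemicontinuous
    exact this.measurable
  ne_top f n := by
    obtain ⟨M, _, hM⟩ := exists_schwartz_norm_le f
    exact ((hL.radialSup_le f M hM n).trans_lt ENNReal.ofReal_lt_top).ne
  add_le f g n := radialSup_le_iff.2 fun r hr => by
    rw [hL.add]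
    exact (enorm_add_le _ _).trans (add_le_add (le_radialSup L f n hr) (le_radialSup L g n hr))

/-- The summand `1` makes the bound visibly positive, as the `L^∞` interpolation requires. -/
theorem isRadialFamily_sphMean :
    IsRadialFamily (fun f : 𝓢(N v, ℂ) => sphMean f) ((sphereMeasure v).real univ + 1) where
  add := sphMean_add
  continuous f r := (continuous_sphMean f).comp (Continuous.prodMk_left r)
  bound f M hM n r := by
    have hM0 : 0 ≤ M := (norm_nonneg _).trans (hM 0)
    have := norm_sphMean_le hM n r
    linarith

theorem exists_norm_profile_le (k : ℕ) : ∃ P : ℝ, 0 < P ∧ ∀ u ∈ Icc (1 : ℝ) 2, ‖profile k u‖ ≤ P := by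
  obtain ⟨P, hP⟩ := isCompact_Icc.exists_bound_of_continuousOn
    (continuous_profile k).continuousOn (s := Icc (1 : ℝ) 2)
  exact ⟨max P 1, by positivity, fun u hu => (hP u hu).trans (le_max_left _ _)⟩

/-- A bound for the profile on `[1, 2]`. -/
noncomputable def profileBound (k : ℕ) : ℝ := (exists_norm_profile_le k).choose

theorem profileBound_pos (k : ℕ) : 0 < profileBound k := (exists_norm_profile_le k).choose_spec.1

theorem norm_profile_le (k : ℕ) {u : ℝ} (hu : u ∈ Icc (1 : ℝ) 2) : ‖profile k u‖ ≤ profileBound k :=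
  (exists_norm_profile_le k).choose_spec.2 u hu

theorem isRadialFamily_radialAvg (k : ℕ) (ε : ℝ) :
    IsRadialFamily (fun (f : 𝓢(N v, ℂ)) n r => radialAvg k (sphMean f n) r ε)
      (profileBound k * ((sphereMeasure v).real univ + 1)) where
  add f g n r := by
    have hi : ∀ f : 𝓢(N v, ℂ), IntervalIntegrable
        (fun u => profile k u • sphMean f n (r + r * ε * u)) volume 1 2 := by
      intro f
      have hu : Continuous fun u : ℝ => (n, r + r * ε * u) := by fun_prop
      exact ((continuous_profile k).smul
        ((continuous_sphMean f).comp hu)).intervalIntegrable _ _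
    simp only [radialAvg]
    rw [← intervalIntegral.integral_add (hi f) (hi g)]
    simp only [← smul_add, ← sphMean_add]
  continuous f r := by
    refine intervalIntegral.continuous_parametric_intervalIntegral_of_continuous' ?_ _ _
    have hu : Continuous fun q : N v × ℝ => (q.1, r + r * ε * q.2) := by fun_prop
    exact ((continuous_profile k).comp continuous_snd).smul ((continuous_sphMean f).comp hu)
  bound f M hM n r := by
    have h := intervalIntegral.norm_integral_le_of_norm_le_const (a := (1 : ℝ)) (b := 2)
      (f := fun u => profile k u • sphMean f n (r + r * ε * u))
      (C := profileBound k * ((sphereMeasure v).real univ + 1) * M) (by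
        intro u hu
        rw [uIoc_of_le one_le_two] at hu
        rw [norm_smul, mul_assoc (profileBound k)]
        exact mul_le_mul (norm_profile_le k (Ioc_subset_Icc_self hu))
          (isRadialFamily_sphMean.bound f M hM n _) (norm_nonneg _) (profileBound_pos k).le)
    norm_num at h
    exact h

theorem isRadialFamily_radialAvg_sub (k : ℕ) (ε δ : ℝ) :
    IsRadialFamily (fun (f : 𝓢(N v, ℂ)) n r =>
      radialAvg k (sphMean f n) r ε - radialAvg k (sphMean f n) r δ)
      (2 * (profileBound k * ((sphereMeasure v).real univ + 1))) where
  add f g n r := by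
    have h1 := (isRadialFamily_radialAvg k ε).add f g n r
    have h2 := (isRadialFamily_radialAvg k δ).add f g n r
    rw [h1, h2]
    ring
  continuous f r := ((isRadialFamily_radialAvg k ε).continuous f r).sub
    ((isRadialFamily_radialAvg k δ).continuous f r)
  bound f M hM n r := by
    have h1 := (isRadialFamily_radialAvg k ε).bound f M hM n r
    have h2 := (isRadialFamily_radialAvg k δ).bound f M hM n r
    have := norm_sub_le (radialAvg k (sphMean f n) r ε) (radialAvg k (sphMean f n) r δ)
    linarith

/-! ### Pointwise bounds for radial averages -/

theorem lintegral_Ioc_affine_le {Φ : ℝ → ℝ≥0∞} (hΦ : Measurable Φ) {r β : ℝ} (hβ : 0 < β) :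
    ∫⁻ u in Ioc (1 : ℝ) 2, Φ (r + β * u) ≤
      ENNReal.ofReal β⁻¹ * ∫⁻ s in Ioc r (r + 2 * β), Φ s := by
  have hm : Measurable ((Ioc r (r + 2 * β)).indicator Φ) := hΦ.indicator measurableSet_Ioc
  rw [← lintegral_indicator measurableSet_Ioc, ← lintegral_indicator measurableSet_Ioc,
    ← lintegral_add_left_eq_self ((Ioc r (r + 2 * β)).indicator Φ) r,
    lintegral_comp_smul (f := fun x => (Ioc r (r + 2 * β)).indicator Φ (r + x)) volume hβ
    (hm.comp (measurable_const_add r)), ← mul_assoc, Module.finrank_self, pow_one,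
    ← ENNReal.ofReal_mul (by positivity), inv_mul_cancel₀ hβ.ne', ENNReal.ofReal_one, one_mul]
  refine lintegral_mono fun u => ?_
  by_cases hu : u ∈ Ioc (1 : ℝ) 2
  · have : r + β • u ∈ Ioc r (r + 2 * β) := by
      rw [smul_eq_mul]
      constructor <;> nlinarith [hu.1, hu.2]
    rw [indicator_of_mem hu]
    rw [indicator_of_mem this, smul_eq_mul]
  · rw [indicator_of_notMem hu]
    exact zero_le

/-- Since `s ≥ r`, the weight `(s / r)^k` is at least `1`. It is inserted with the polar exponent `Q
- 1` and with the exponent of the square function. -/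
theorem lintegral_Ioc_le_weighted (Φ : ℝ → ℝ≥0∞) {r R : ℝ} (hr : 0 < r) (k : ℕ) :
    ∫⁻ s in Ioc r R, Φ s ≤
      ENNReal.ofReal (r ^ k)⁻¹ * ∫⁻ s in Ioc r R, Φ s * ENNReal.ofReal (s ^ k) := by
  rw [← lintegral_const_mul' _ _ ENNReal.ofReal_ne_top]
  refine setLIntegral_mono' measurableSet_Ioc fun s hs => ?_
  have h1 : 1 ≤ ENNReal.ofReal (r ^ k)⁻¹ * ENNReal.ofReal (s ^ k) := by
    rw [← ENNReal.ofReal_mul (by positivity), ENNReal.one_le_ofReal, inv_mul_eq_div,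
      one_le_div (by positivity)]
    exact pow_le_pow_left₀ hr.le hs.1.le k
  calc Φ s = 1 * Φ s := (one_mul _).symm
    _ ≤ (ENNReal.ofReal (r ^ k)⁻¹ * ENNReal.ofReal (s ^ k)) * Φ s := by gcongr
    _ = _ := by ring

/-- Spherical means integrated over radii up to `R` are an integral over a ball. -/
theorem lintegral_spherical_le_hlMaximal (hv : 1 ≤ v) {g : N v → ℝ≥0∞} (hg : Measurable g)
    (n : N v) {r R : ℝ} (hr : 0 < r) (hR : 0 < R) :
    ∫⁻ s in Ioc r R, (∫⁻ m, g (n * (dil s m)⁻¹) ∂(sphereMeasure v)) *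
        ENNReal.ofReal (s ^ (homDim v - 1)) ≤
      ENNReal.ofReal (2 * R) ^ homDim v * hlMaximal g n := by
  have hball : MeasurableSet {m : N v | koranyiNorm m ≤ R} :=
    measurable_koranyiNorm measurableSet_Iic
  have hgm : Measurable fun m : N v => g (n * m⁻¹) :=
    hg.comp ((measurable_const_mul n).comp measurable_inv)
  refine le_trans ?_ (setLIntegral_box_le_hlMaximal hg n hR)
  calc _ ≤ ∫⁻ s in Ioi (0 : ℝ), (∫⁻ m, {m : N v | koranyiNorm m ≤ R}.indicator
        (fun m => g (n * m⁻¹)) (dil s m) ∂(sphereMeasure v)) *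
        ENNReal.ofReal (s ^ (homDim v - 1)) := by
        refine (setLIntegral_mono' measurableSet_Ioc fun s hs => ?_).trans
          (lintegral_mono_set fun s hs => hr.trans hs.1)
        refine mul_le_mul_left (lintegral_mono_ae ?_) _
        have : ∀ᵐ m ∂(sphereMeasure v), koranyiNorm m = 1 := sphereMeasure_compl hv
        filter_upwards [this] with m hm
        rw [indicator_of_mem]
        change koranyiNorm (dil s m) ≤ R
        rw [koranyiNorm_dil (hr.trans hs.1).le, hm, mul_one]
        exact hs.2
    _ = ∫⁻ m, {m : N v | koranyiNorm m ≤ R}.indicator (fun m => g (n * m⁻¹)) m :=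
        (lintegral_polar hv (hgm.indicator hball)).symm
    _ = ∫⁻ m in {m : N v | koranyiNorm m ≤ R}, g (n * m⁻¹) := lintegral_indicator hball _
    _ ≤ _ := lintegral_mono_set fun m hm => mem_box_of_koranyiNorm_le hm

/-- For `ε ≤ 1` all radii lie in `[r, 3r]`. The change of variables costs `(rε)⁻¹`, the polar weight
`r^(1-Q)`, and the ball of radius `3r` gives `(6r)^Q`; the powers of `r` cancel and `6^Q ε⁻¹`
remains. -/
theorem enorm_radialAvg_le_hlMaximal (hv : 1 ≤ v) (f : 𝓢(N v, ℂ)) (n : N v) (k : ℕ) {r ε : ℝ}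
    (hr : 0 < r) (hε : 0 < ε) (hε1 : ε ≤ 1) :
    ‖radialAvg k (sphMean f n) r ε‖ₑ ≤
      ENNReal.ofReal (profileBound k * 6 ^ homDim v * ε⁻¹) * hlMaximal (fun n => ‖f n‖ₑ) n := by
  have hg : Measurable fun n => ‖f n‖ₑ := f.continuous.enorm.measurable
  set Φ : ℝ → ℝ≥0∞ := fun s => ∫⁻ m, ‖f (n * (dil s m)⁻¹)‖ₑ ∂(sphereMeasure v) with hΦ
  have hΦm : Measurable Φ := by
    have : Measurable fun q : ℝ × N v => ‖f (n * (dil q.1 q.2)⁻¹)‖ₑ :=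
      (f.continuous.comp (contDiff_translate_dil n).continuous).enorm.measurable
    exact this.lintegral_prod_right'
  have hP := profileBound_pos k
  have hQ : homDim v ≠ 0 := by rw [homDim_eq]; positivity
  have hsub : r + 2 * (r * ε) ≤ 3 * r := by nlinarith
  calc ‖radialAvg k (sphMean f n) r ε‖ₑ
      ≤ ∫⁻ u in Ioc (1 : ℝ) 2, ‖profile k u • sphMean f n (r + r * ε * u)‖ₑ := by
        rw [radialAvg, intervalIntegral.integral_of_le one_le_two]
        exact enorm_integral_le_lintegral_enorm _
    _ ≤ ∫⁻ u in Ioc (1 : ℝ) 2, ENNReal.ofReal (profileBound k) * Φ (r + r * ε * u) := by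
        refine setLIntegral_mono' measurableSet_Ioc fun u hu => ?_
        rw [enorm_smul]
        refine mul_le_mul' ?_ (enorm_integral_le_lintegral_enorm _)
        rw [← ofReal_norm]
        exact ENNReal.ofReal_le_ofReal (norm_profile_le k (Ioc_subset_Icc_self hu))
    _ ≤ ENNReal.ofReal (profileBound k) * (ENNReal.ofReal (r * ε)⁻¹ *
          ∫⁻ s in Ioc r (r + 2 * (r * ε)), Φ s) := by
        rw [lintegral_const_mul' _ _ ENNReal.ofReal_ne_top]
        gcongr
        exact lintegral_Ioc_affine_le hΦm (by positivity)
    _ ≤ ENNReal.ofReal (profileBound k) * (ENNReal.ofReal (r * ε)⁻¹ *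
          (ENNReal.ofReal (r ^ (homDim v - 1))⁻¹ *
          (ENNReal.ofReal (2 * (3 * r)) ^ homDim v * hlMaximal (fun n => ‖f n‖ₑ) n))) := by
        gcongr
        refine (lintegral_mono_set (Ioc_subset_Ioc_right hsub)).trans ?_
        refine (lintegral_Ioc_le_weighted Φ hr (homDim v - 1)).trans ?_
        gcongr
        exact lintegral_spherical_le_hlMaximal hv hg n hr (by positivity)
    _ = _ := by
        rw [← mul_assoc, ← mul_assoc, ← mul_assoc, ← ENNReal.ofReal_pow (by positivity),
          ← ENNReal.ofReal_mul (by positivity), ← ENNReal.ofReal_mul (by positivity),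
          ← ENNReal.ofReal_mul (by positivity)]
        congr 2
        obtain ⟨j, hj⟩ : ∃ j, homDim v = j + 1 := ⟨homDim v - 1, by omega⟩
        rw [hj, Nat.add_sub_cancel, ← mul_assoc, mul_pow]
        field_simp
        norm_num
        ring

theorem lintegral_Ioc_one_two_le {g : ℝ → ℝ≥0∞} (hg : Measurable g) :
    ∫⁻ u in Ioc (1 : ℝ) 2, g u ≤ (∫⁻ u in Ioc (1 : ℝ) 2, g u ^ 2) ^ (1 / 2 : ℝ) := by
  have h := ENNReal.lintegral_mul_le_Lp_mul_Lq (volume.restrict (Ioc (1 : ℝ) 2))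
    Real.HolderConjugate.two_two hg.aemeasurable (aemeasurable_const (b := (1 : ℝ≥0∞)))
  have e : (2 : ℝ) - 1 = 1 := by norm_num
  simpa [e] using h

/-- The square integral of the `j`-th radial derivative occurring in the square function. -/
noncomputable def radialSquare (j : ℕ) (F : ℝ → ℂ) : ℝ≥0∞ :=
  (∫⁻ s in Ioi (0 : ℝ), ‖iteratedDeriv j F s‖ₑ ^ 2 * ENNReal.ofReal (s ^ (2 * j - 1))) ^ (1 / 2 : ℝ)

/-- Cauchy-Schwarz on `[1, 2]`, then `s = r + rεu`. The prefactor `r (rε)^k` meets `(rε)^(-1/2)`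
from the substitution and `r^(-(2k+1)/2)` from the weight: the total power of `r` is zero, so the
bound survives a supremum over `r`. -/
theorem enorm_deriv_radialAvg_le {F : ℝ → ℂ} (hF : ContDiff ℝ (⊤ : ℕ∞) F) (k : ℕ) {r ε : ℝ}
    (hr : 0 < r) (hε : 0 < ε) :
    ‖(r * (-(r * ε)) ^ k) •
        ∫ u in (1 : ℝ)..2, bump u • iteratedDeriv (k + 1) F (r + r * ε * u)‖ₑ ≤
      ENNReal.ofReal (ε ^ k * (ε ^ (1 / 2 : ℝ))⁻¹) * radialSquare (k + 1) F := by
  have hc : Continuous (iteratedDeriv (k + 1) F) := (contDiff_iteratedDeriv hF (k + 1)).continuous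
  set Φ : ℝ → ℝ≥0∞ := fun s => ‖iteratedDeriv (k + 1) F s‖ₑ with hΦ
  have hΦm : Measurable Φ := hc.enorm.measurable
  have h1 : ‖∫ u in (1 : ℝ)..2, bump u • iteratedDeriv (k + 1) F (r + r * ε * u)‖ₑ ≤
      ∫⁻ u in Ioc (1 : ℝ) 2, Φ (r + r * ε * u) := by
    rw [intervalIntegral.integral_of_le one_le_two]
    refine (enorm_integral_le_lintegral_enorm _).trans (lintegral_mono fun u => ?_)
    rw [enorm_smul]
    refine mul_le_of_le_one_left' ?_
    rw [← ofReal_norm, Real.norm_eq_abs, abs_of_nonneg bump.nonneg]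
    exact ENNReal.ofReal_le_one.2 bump.le_one
  have h2 : ∫⁻ u in Ioc (1 : ℝ) 2, Φ (r + r * ε * u) ≤
      (ENNReal.ofReal (r * ε)⁻¹ * (ENNReal.ofReal (r ^ (2 * k + 1))⁻¹ *
        ∫⁻ s in Ioi (0 : ℝ), Φ s ^ 2 * ENNReal.ofReal (s ^ (2 * k + 1)))) ^ (1 / 2 : ℝ) := by
    refine (lintegral_Ioc_one_two_le (hΦm.comp (by fun_prop))).trans ?_
    gcongr
    refine (lintegral_Ioc_affine_le (Φ := fun s => Φ s ^ 2) (hΦm.pow_const 2)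
      (by positivity)).trans ?_
    gcongr
    refine (lintegral_Ioc_le_weighted _ hr (2 * k + 1)).trans ?_
    gcongr
    exact fun s hs => hr.trans hs.1
  have e1 : ‖r * (-(r * ε)) ^ k‖ₑ = ENNReal.ofReal (r * (r * ε) ^ k) := by
    rw [← ofReal_norm, norm_mul, norm_pow, norm_neg, Real.norm_of_nonneg hr.le,
      Real.norm_of_nonneg (by positivity)]
  have e2 : radialSquare (k + 1) F =
      (∫⁻ s in Ioi (0 : ℝ), Φ s ^ 2 * ENNReal.ofReal (s ^ (2 * k + 1))) ^ (1 / 2 : ℝ) := rfl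
  rw [enorm_smul, e1, e2]
  refine (mul_le_mul_right (h1.trans h2) _).trans_eq ?_
  rw [← mul_assoc (ENNReal.ofReal (r * ε)⁻¹), ← ENNReal.ofReal_mul (by positivity),
    ENNReal.mul_rpow_of_nonneg _ _ (by positivity), ← mul_assoc,
    ENNReal.ofReal_rpow_of_nonneg (by positivity) (by positivity),
    ← ENNReal.ofReal_mul (by positivity)]
  congr 2
  have e3 : (r * ε)⁻¹ * (r ^ (2 * k + 1))⁻¹ = ((r ^ (k + 1)) ^ 2)⁻¹ * ε⁻¹ := by
    field_simp
    ring
  rw [e3, Real.mul_rpow (by positivity) (by positivity), ← inv_pow, Real.inv_rpow hε.le,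
    ← Real.sqrt_eq_rpow ((_ : ℝ) ^ 2), Real.sqrt_sq (by positivity)]
  field_simp
  ring

/-- Mean value inequality on `[ε/2, ε]`: a derivative of order `ε^(k - 1/2)` over an interval of
length `ε / 2`. -/
theorem enorm_radialAvg_sub_half_le {F : ℝ → ℂ} (hF : ContDiff ℝ (⊤ : ℕ∞) F) (k : ℕ) {r ε : ℝ}
    (hr : 0 < r) (hε : 0 < ε) :
    ‖radialAvg k F r ε - radialAvg k F r (ε / 2)‖ₑ ≤
      ENNReal.ofReal (ε ^ k * ε ^ (1 / 2 : ℝ)) * radialSquare (k + 1) F := by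
  by_cases htop : radialSquare (k + 1) F = ∞
  · rw [htop, ENNReal.mul_top (ENNReal.ofReal_pos.2 (by positivity)).ne']
    exact le_top
  set S := (radialSquare (k + 1) F).toReal with hS
  have hS0 : 0 ≤ S := ENNReal.toReal_nonneg
  have hSe : radialSquare (k + 1) F = ENNReal.ofReal S := (ENNReal.ofReal_toReal htop).symm
  have hbound : ∀ δ ∈ Icc (ε / 2) ε, ‖(r * (-(r * δ)) ^ k) •
      ∫ u in (1 : ℝ)..2, bump u • iteratedDeriv (k + 1) F (r + r * δ * u)‖ ≤
      ε ^ k * ((ε / 2) ^ (1 / 2 : ℝ))⁻¹ * S := by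
    intro δ hδ
    have hδ0 : 0 < δ := (half_pos hε).trans_le hδ.1
    have h := enorm_deriv_radialAvg_le hF k hr hδ0
    rw [hSe, ← ENNReal.ofReal_mul (by positivity), ← ofReal_norm,
      ENNReal.ofReal_le_ofReal_iff (by positivity)] at h
    refine h.trans ?_
    gcongr
    · exact hδ.2
    · exact hδ.1
  have hmv := Convex.norm_image_sub_le_of_norm_hasDerivWithin_le
    (fun δ _ => (hasDerivAt_radialAvg hF k r δ).hasDerivWithinAt) hbound (convex_Icc (ε / 2) ε)
    (left_mem_Icc.2 (by linarith)) (right_mem_Icc.2 (by linarith))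
  rw [hSe, ← ENNReal.ofReal_mul (by positivity), ← ofReal_norm]
  refine ENNReal.ofReal_le_ofReal (hmv.trans ?_)
  have e1 : ‖ε - ε / 2‖ = ε / 2 := by
    rw [sub_half, Real.norm_of_nonneg (by positivity)]
  have e2 : ε / 2 = (ε / 2) ^ (1 / 2 : ℝ) * (ε / 2) ^ (1 / 2 : ℝ) := by
    rw [← Real.rpow_add (by positivity)]
    norm_num
  have e3 : 0 < (ε / 2) ^ (1 / 2 : ℝ) := by positivity
  rw [e1]
  calc ε ^ k * ((ε / 2) ^ (1 / 2 : ℝ))⁻¹ * S * (ε / 2)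
      = ε ^ k * ((ε / 2) ^ (1 / 2 : ℝ))⁻¹ * S *
        ((ε / 2) ^ (1 / 2 : ℝ) * (ε / 2) ^ (1 / 2 : ℝ)) := by rw [← e2]
    _ = ε ^ k * (ε / 2) ^ (1 / 2 : ℝ) * S := by field_simp
    _ ≤ ε ^ k * ε ^ (1 / 2 : ℝ) * S := by
        gcongr
        linarith

/-! ### From pointwise bounds to weak, strong and norm inequalities -/

theorem weakType_of_le_hlMaximal (hv : 1 ≤ v) {T : 𝓢(N v, ℂ) → N v → ℝ≥0∞} {c : ℝ} (hc : 0 < c)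
    (h : ∀ f n, T f n ≤ ENNReal.ofReal c * hlMaximal (fun n => ‖f n‖ₑ) n) :
    WeakType T 1 (weakConst v * ENNReal.ofReal c) := by
  intro f t ht
  have hsub : {n | ENNReal.ofReal t < T f n} ⊆
      {n | ENNReal.ofReal (t / c) < hlMaximal (fun n => ‖f n‖ₑ) n} := by
    intro n hn
    by_contra hcon
    have h1 : T f n ≤ ENNReal.ofReal t := by
      refine (h f n).trans ((mul_le_mul_right (not_lt.1 hcon) _).trans_eq ?_)
      rw [← ENNReal.ofReal_mul hc.le, mul_div_cancel₀ _ hc.ne']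
    exact absurd hn (not_lt.2 h1)
  have hw := mul_volume_lt_hlMaximal_le hv (fun n => ‖f n‖ₑ)
    (ENNReal.ofReal_pos.2 (div_pos ht hc)).ne'
  have e : ENNReal.ofReal (c / t) * ENNReal.ofReal (t / c) = 1 := by
    rw [← ENNReal.ofReal_mul (by positivity), ← ENNReal.ofReal_one]
    congr 1
    field_simp
  simp only [ENNReal.rpow_one]
  calc volume {n | ENNReal.ofReal t < T f n}
      ≤ volume {n | ENNReal.ofReal (t / c) < hlMaximal (fun n => ‖f n‖ₑ) n} := measure_mono hsub
    _ = ENNReal.ofReal (c / t) * (ENNReal.ofReal (t / c) *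
          volume {n | ENNReal.ofReal (t / c) < hlMaximal (fun n => ‖f n‖ₑ) n}) := by
        rw [← mul_assoc, e, one_mul]
    _ ≤ ENNReal.ofReal (c / t) * (weakConst v * ∫⁻ n, ‖f n‖ₑ) := mul_le_mul_right hw _
    _ = _ := by
        rw [Real.rpow_neg_one, div_eq_mul_inv, ENNReal.ofReal_mul hc.le]
        ring

theorem eLpNorm_ofReal_eq {E : Type*} [TopologicalSpace E] [ContinuousENorm E] {p : ℝ} (hp : 0 < p)
    (g : N v → E) :
    eLpNorm g (ENNReal.ofReal p) volume = (∫⁻ n, ‖g n‖ₑ ^ p) ^ (1 / p) := by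
  rw [eLpNorm_eq_lintegral_rpow_enorm_toReal (ENNReal.ofReal_pos.2 hp).ne' ENNReal.ofReal_ne_top,
    ENNReal.toReal_ofReal hp.le]

theorem LpInequality.exists_strongType {T : (N v → ℂ) → N v → ℝ≥0∞} {p : ℝ} (hp : 0 < p)
    (h : LpInequality T (ENNReal.ofReal p)) :
    ∃ C : ℝ≥0, 0 < C ∧ StrongType (fun f => T f) p C := by
  obtain ⟨C, hC, h⟩ := h
  -- Strong type constants refer to `p`-th powers of norms.
  refine ⟨C ^ p, NNReal.rpow_pos hC, fun f => ?_⟩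
  have := h f
  rw [eLpNorm_ofReal_eq hp, eLpNorm_ofReal_eq hp] at this
  have h2 := ENNReal.rpow_le_rpow this hp.le
  rw [ENNReal.mul_rpow_of_nonneg _ _ hp.le, ← ENNReal.rpow_mul, ← ENNReal.rpow_mul,
    one_div_mul_cancel hp.ne', ENNReal.rpow_one, ENNReal.rpow_one,
    ← ENNReal.coe_rpow_of_nonneg _ hp.le] at h2
  exact h2

theorem StrongType.lpInequality {T : (N v → ℂ) → N v → ℝ≥0∞} {p : ℝ} (hp : 0 < p) {C : ℝ≥0∞}
    (hC : C ≠ ∞) (h : StrongType (fun f => T f) p C) : LpInequality T (ENNReal.ofReal p) := by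
  lift C to ℝ≥0 using hC
  refine ⟨(C + 1) ^ (1 / p), NNReal.rpow_pos (by positivity), fun f => ?_⟩
  rw [eLpNorm_ofReal_eq hp, eLpNorm_ofReal_eq hp,
    ENNReal.coe_rpow_of_nonneg _ (by positivity), ← ENNReal.mul_rpow_of_nonneg _ _ (by positivity)]
  refine ENNReal.rpow_le_rpow ((h f).trans ?_) (by positivity)
  gcongr
  simp

/-- The bound holds almost everywhere, hence on a dense set, which is closed by continuity of `f`.
-/
theorem norm_le_of_eLpNorm_top (f : 𝓢(N v, ℂ)) (n : N v) :
    ‖f n‖ ≤ (eLpNorm f ∞ volume).toReal := by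
  obtain ⟨M, _, hM⟩ := exists_schwartz_norm_le f
  have hfin : eLpNorm f ∞ volume ≠ ∞ := by
    refine ((eLpNorm_le_of_ae_bound (C := M) (Filter.Eventually.of_forall hM)).trans_lt ?_).ne
    simp
  have hae : ∀ᵐ n : N v, ‖f n‖ ≤ (eLpNorm f ∞ volume).toReal := by
    filter_upwards [ae_le_eLpNormEssSup (f := f) (μ := (volume : Measure (N v)))] with n hn
    rw [← toReal_enorm]
    rw [← eLpNorm_exponent_top] at hn
    exact ENNReal.toReal_mono hfin hn
  have hd : Dense {n : N v | ‖f n‖ ≤ (eLpNorm f ∞ volume).toReal} := Measure.dense_of_ae hae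
  have hc : IsClosed {n : N v | ‖f n‖ ≤ (eLpNorm f ∞ volume).toReal} :=
    isClosed_le f.continuous.norm continuous_const
  have : n ∈ {n : N v | ‖f n‖ ≤ (eLpNorm f ∞ volume).toReal} := by
    rw [← hc.closure_eq, hd.closure_eq]
    trivial
  exact this

theorem sphericalMaximal_eq_radialSup (f : 𝓢(N v, ℂ)) :
    sphericalMaximal v f = radialSup (fun f : 𝓢(N v, ℂ) => sphMean f) f :=
  funext fun n => sphericalMaximal_eq f n

theorem lpInequality_sphericalMaximal_top : LpInequality (sphericalMaximal v) ∞ := by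
  have hB : 0 < (sphereMeasure v).real univ + 1 := by positivity
  refine ⟨Real.toNNReal ((sphereMeasure v).real univ + 1), Real.toNNReal_pos.2 hB, fun f => ?_⟩
  obtain ⟨M, _, hM⟩ := exists_schwartz_norm_le f
  have hfin : eLpNorm f ∞ volume ≠ ∞ := by
    refine ((eLpNorm_le_of_ae_bound (C := M) (Filter.Eventually.of_forall hM)).trans_lt ?_).ne
    simp
  rw [sphericalMaximal_eq_radialSup, eLpNorm_exponent_top]
  refine eLpNormEssSup_le_of_ae_enorm_bound (Filter.Eventually.of_forall fun n => ?_)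
  refine (isRadialFamily_sphMean.radialSup_le f _ (norm_le_of_eLpNorm_top f) n).trans_eq ?_
  rw [ENNReal.ofReal_mul hB.le, ENNReal.ofReal_toReal hfin]
  rfl

/-! ### Summation over the scales -/

/-- `L^q` bounds for a geometrically convergent series of nonnegative functions. -/
theorem exists_lintegral_tsum_rpow_le {α : Type*} [MeasurableSpace α] (μ : Measure α) {q σ : ℝ}
    (hq : 0 < q) (hσ0 : 0 < σ) (hσ1 : σ < 1) :
    ∃ K : ℝ≥0∞, K ≠ ∞ ∧ ∀ (T : ℕ → α → ℝ≥0∞) (C : ℝ≥0∞), (∀ i, Measurable (T i)) →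
      (∀ i, ∫⁻ x, T i x ^ q ∂μ ≤ C * ENNReal.ofReal σ ^ i) →
      ∫⁻ x, (∑' i, T i x) ^ q ∂μ ≤ K * C := by
  have hgeom : ∀ ρ : ℝ, ρ < 1 → ∑' i : ℕ, ENNReal.ofReal ρ ^ i ≠ ∞ := by
    intro ρ hρ
    rw [ENNReal.tsum_geometric]
    exact ENNReal.inv_ne_top.2 (tsub_pos_iff_lt.2 (ENNReal.ofReal_lt_one.2 hρ)).ne'
  -- Half of the decay is spent on the pointwise sum: weighting by `ρ⁻ⁱ` leaves the ratio `ρ^(-q) σ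
  -- = σ^(1/2) = τ`.
  set ρ : ℝ := σ ^ (1 / (2 * q)) with hρ
  have hρ0 : 0 < ρ := by positivity
  have hρ1 : ρ < 1 := Real.rpow_lt_one hσ0.le hσ1 (by positivity)
  set τ : ℝ := σ ^ (1 / 2 : ℝ) with hτ
  have hτ1 : τ < 1 := Real.rpow_lt_one hσ0.le hσ1 (by positivity)
  refine ⟨(∑' i : ℕ, ENNReal.ofReal ρ ^ i) ^ q * ∑' i : ℕ, ENNReal.ofReal τ ^ i,
    ENNReal.mul_ne_top (ENNReal.rpow_ne_top_of_nonneg hq.le (hgeom ρ hρ1)) (hgeom τ hτ1), ?_⟩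
  intro T C hT hC
  have hinv : ∀ i : ℕ, ENNReal.ofReal ρ ^ i * ENNReal.ofReal ρ⁻¹ ^ i = 1 := by
    intro i
    rw [← mul_pow, ← ENNReal.ofReal_mul hρ0.le, mul_inv_cancel₀ hρ0.ne', ENNReal.ofReal_one,
      one_pow]
  have hpt : ∀ x, (∑' i, T i x) ^ q ≤
      (∑' i : ℕ, ENNReal.ofReal ρ ^ i) ^ q * ∑' i, (ENNReal.ofReal ρ⁻¹ ^ i * T i x) ^ q := by
    intro x
    set S := ∑' i, (ENNReal.ofReal ρ⁻¹ ^ i * T i x) ^ q with hS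
    -- Bounding one term by the whole weighted sum avoids Minkowski's inequality.
    have h1 : ∀ i, T i x ≤ ENNReal.ofReal ρ ^ i * S ^ (1 / q) := by
      intro i
      calc T i x = ENNReal.ofReal ρ ^ i * (ENNReal.ofReal ρ⁻¹ ^ i * T i x) := by
            rw [← mul_assoc, hinv, one_mul]
        _ = ENNReal.ofReal ρ ^ i * ((ENNReal.ofReal ρ⁻¹ ^ i * T i x) ^ q) ^ (1 / q) := by
            rw [← ENNReal.rpow_mul, mul_one_div_cancel hq.ne', ENNReal.rpow_one]
        _ ≤ _ := by
            gcongr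
            exact ENNReal.le_tsum i
    calc (∑' i, T i x) ^ q ≤ (∑' i, ENNReal.ofReal ρ ^ i * S ^ (1 / q)) ^ q := by
          gcongr with i
          exact h1 i
      _ = _ := by
          rw [ENNReal.tsum_mul_right, ENNReal.mul_rpow_of_nonneg _ _ hq.le, ← ENNReal.rpow_mul,
            one_div_mul_cancel hq.ne', ENNReal.rpow_one]
  have hρq : ENNReal.ofReal ρ⁻¹ ^ q * ENNReal.ofReal σ = ENNReal.ofReal τ := by
    rw [ENNReal.ofReal_rpow_of_nonneg (by positivity) hq.le, ← ENNReal.ofReal_mul (by positivity)]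
    congr 1
    rw [hρ, hτ, ← Real.rpow_neg hσ0.le, ← Real.rpow_mul hσ0.le, ← Real.rpow_add_one hσ0.ne']
    congr 1
    field_simp
    norm_num
  calc ∫⁻ x, (∑' i, T i x) ^ q ∂μ
      ≤ ∫⁻ x, (∑' i : ℕ, ENNReal.ofReal ρ ^ i) ^ q *
          ∑' i, (ENNReal.ofReal ρ⁻¹ ^ i * T i x) ^ q ∂μ := lintegral_mono hpt
    _ = (∑' i : ℕ, ENNReal.ofReal ρ ^ i) ^ q *
          ∑' i, ∫⁻ x, (ENNReal.ofReal ρ⁻¹ ^ i * T i x) ^ q ∂μ := by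
        rw [lintegral_const_mul' _ _ (ENNReal.rpow_ne_top_of_nonneg hq.le (hgeom ρ hρ1)),
          lintegral_tsum fun i => (((hT i).const_mul _).pow_const q).aemeasurable]
    _ ≤ (∑' i : ℕ, ENNReal.ofReal ρ ^ i) ^ q * ∑' i : ℕ, ENNReal.ofReal τ ^ i * C := by
        gcongr with i
        simp_rw [ENNReal.mul_rpow_of_nonneg _ _ hq.le]
        rw [lintegral_const_mul _ ((hT i).pow_const q)]
        calc _ ≤ (ENNReal.ofReal ρ⁻¹ ^ i) ^ q * (C * ENNReal.ofReal σ ^ i) :=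
              mul_le_mul_right (hC i) _
          _ = (ENNReal.ofReal ρ⁻¹ ^ q * ENNReal.ofReal σ) ^ i * C := by
              rw [mul_pow, ← ENNReal.rpow_natCast, ← ENNReal.rpow_mul, mul_comm (i : ℝ),
                ENNReal.rpow_mul, ENNReal.rpow_natCast]
              ring
          _ = _ := by rw [hρq]
    _ = _ := by rw [ENNReal.tsum_mul_right, mul_assoc]

/-- The maximal operator of the radial averages at scale `1`. -/
noncomputable def coarseMaximal (v k : ℕ) : 𝓢(N v, ℂ) → N v → ℝ≥0∞ :=
  radialSup fun f n r => radialAvg k (sphMean f n) r 1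

/-- The maximal operator of the differences of radial averages at the scales `2⁻ⁱ`, `2⁻ⁱ⁻¹`. -/
noncomputable def diffMaximal (v k i : ℕ) : 𝓢(N v, ℂ) → N v → ℝ≥0∞ :=
  radialSup fun f n r => radialAvg k (sphMean f n) r ((1 / 2) ^ i) -
    radialAvg k (sphMean f n) r ((1 / 2) ^ i / 2)

theorem isSubadditiveOp_coarseMaximal (k : ℕ) : IsSubadditiveOp (coarseMaximal v k) :=
  (isRadialFamily_radialAvg k 1).isSubadditiveOp

theorem isSubadditiveOp_diffMaximal (k i : ℕ) : IsSubadditiveOp (diffMaximal v k i) :=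
  (isRadialFamily_radialAvg_sub k _ _).isSubadditiveOp

/-- Telescoping from `ε = 1` down to `2⁻ᴷ`, with `K → ∞`: the average is continuous at `ε = 0`,
where it equals `profileMass k` times the spherical mean. -/
theorem profileMass_mul_radialSup_le (hv : 1 ≤ v) (k : ℕ) (f : 𝓢(N v, ℂ)) (n : N v) :
    ENNReal.ofReal (profileMass k) * radialSup (fun f : 𝓢(N v, ℂ) => sphMean f) f n ≤
      coarseMaximal v k f n + ∑' i, diffMaximal v k i f n := by
  have hm := profileMass_pos k
  have key : ∀ r : ℝ, 0 < r → ENNReal.ofReal (profileMass k) * ‖sphMean f n r‖ₑ ≤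
      coarseMaximal v k f n + ∑' i, diffMaximal v k i f n := by
    intro r hr
    set a := radialAvg k (sphMean f n) r with ha
    have hfin : ∀ K : ℕ, ‖a ((1 / 2) ^ K)‖ₑ ≤
        coarseMaximal v k f n + ∑ i ∈ Finset.range K, diffMaximal v k i f n := by
      intro K
      induction K with
      | zero =>
        rw [pow_zero, Finset.sum_range_zero, add_zero]
        exact le_radialSup (fun f n r => radialAvg k (sphMean f n) r 1) f n hr
      | succ K ih =>
        have e : a ((1 / 2) ^ (K + 1)) =
            a ((1 / 2) ^ K) - (a ((1 / 2) ^ K) - a ((1 / 2) ^ K / 2)) := by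
          rw [sub_sub_cancel, pow_succ]
          congr 1
          ring
        rw [e, Finset.sum_range_succ, ← add_assoc]
        exact enorm_sub_le.trans (add_le_add ih (le_radialSup (fun f n r =>
          radialAvg k (sphMean f n) r ((1 / 2) ^ K) -
          radialAvg k (sphMean f n) r ((1 / 2) ^ K / 2)) f n hr))
    have hlim : Filter.Tendsto (fun K : ℕ => ‖a ((1 / 2) ^ K)‖ₑ) Filter.atTop
        (nhds ‖a 0‖ₑ) := by
      have hc : ContinuousAt a 0 :=
        (hasDerivAt_radialAvg (contDiff_sphMean hv f n) k r 0).continuousAt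
      exact (hc.enorm.tendsto).comp
        (tendsto_pow_atTop_nhds_zero_of_lt_one (by norm_num) (by norm_num))
    have h0 : ‖a 0‖ₑ = ENNReal.ofReal (profileMass k) * ‖sphMean f n r‖ₑ := by
      rw [ha, radialAvg_zero, enorm_smul, ← ofReal_norm (profileMass k),
        Real.norm_of_nonneg hm.le]
    rw [← h0]
    refine le_of_tendsto' hlim fun K => (hfin K).trans ?_
    gcongr
    exact ENNReal.sum_le_tsum _
  simp only [radialSup, ENNReal.mul_iSup]
  exact iSup₂_le fun r hr => key r hr

theorem exists_strongType_coarseMaximal (hv : 1 ≤ v) (k : ℕ) {q : ℝ} (hq : 1 < q) :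
    ∃ C : ℝ≥0∞, C ≠ ∞ ∧ StrongType (coarseMaximal v k) q C := by
  have hP := profileBound_pos k
  have hc : 0 < profileBound k * 6 ^ homDim v * (1 : ℝ)⁻¹ := by positivity
  have hw : WeakType (coarseMaximal v k) 1 _ := weakType_of_le_hlMaximal hv hc fun f n =>
    radialSup_le_iff.2 fun r hr => enorm_radialAvg_le_hlMaximal hv f n k hr one_pos le_rfl
  exact hw.strongType_of_bounded (isSubadditiveOp_coarseMaximal k) one_pos hq
    (by positivity : 0 < profileBound k * ((sphereMeasure v).real univ + 1))
    (ENNReal.mul_ne_top weakConst_ne_top ENNReal.ofReal_ne_top)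
    (isRadialFamily_radialAvg k 1).radialSup_le

/-- The two averages contribute `ε⁻¹` and `(ε/2)⁻¹`, whence the factor `3`. -/
theorem weakType_one_diffMaximal (hv : 1 ≤ v) (k i : ℕ) :
    WeakType (diffMaximal v k i) 1
      (weakConst v * ENNReal.ofReal (3 * profileBound k * 6 ^ homDim v * ((1 / 2) ^ i)⁻¹)) := by
  have hP := profileBound_pos k
  refine weakType_of_le_hlMaximal hv (by positivity) fun f n => radialSup_le_iff.2 fun r hr => ?_
  set ε : ℝ := (1 / 2) ^ i with hε
  have hε0 : 0 < ε := by positivity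
  have hε1 : ε ≤ 1 := pow_le_one₀ (by norm_num) (by norm_num)
  refine enorm_sub_le.trans ((add_le_add (enorm_radialAvg_le_hlMaximal hv f n k hr hε0 hε1)
    (enorm_radialAvg_le_hlMaximal hv f n k hr (half_pos hε0) (by linarith))).trans_eq ?_)
  rw [← add_mul, ← ENNReal.ofReal_add (by positivity) (by positivity)]
  congr 2
  field_simp
  ring

theorem strongType_two_diffMaximal (hv : 1 ≤ v) (k i : ℕ) {C : ℝ≥0∞}
    (hS : StrongType (fun f : 𝓢(N v, ℂ) => squareFunction v (k + 1) f) 2 C) :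
    StrongType (diffMaximal v k i) 2 (C * ENNReal.ofReal (((1 / 2) ^ i) ^ (2 * k + 1))) := by
  intro f
  set ε : ℝ := (1 / 2) ^ i with hε
  have hε0 : 0 < ε := by positivity
  have hpt : ∀ n, diffMaximal v k i f n ≤
      ENNReal.ofReal (ε ^ k * ε ^ (1 / 2 : ℝ)) * squareFunction v (k + 1) f n := fun n => by
    rw [squareFunction_eq f.continuous]
    exact radialSup_le_iff.2 fun r hr =>
      enorm_radialAvg_sub_half_le (contDiff_sphMean hv f n) k hr hε0
  have hc : ENNReal.ofReal (ε ^ k * ε ^ (1 / 2 : ℝ)) ^ (2 : ℝ) =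
      ENNReal.ofReal (ε ^ (2 * k + 1)) := by
    rw [ENNReal.ofReal_rpow_of_nonneg (by positivity) two_pos.le,
      Real.mul_rpow (by positivity) (by positivity), ← Real.rpow_mul hε0.le]
    congr 1
    norm_num
    ring
  calc ∫⁻ n, diffMaximal v k i f n ^ (2 : ℝ)
      ≤ ∫⁻ n, ENNReal.ofReal (ε ^ (2 * k + 1)) * squareFunction v (k + 1) f n ^ (2 : ℝ) := by
        refine lintegral_mono fun n => ?_
        rw [← hc, ← ENNReal.mul_rpow_of_nonneg _ _ two_pos.le]
        exact ENNReal.rpow_le_rpow (hpt n) two_pos.le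
    _ = ENNReal.ofReal (ε ^ (2 * k + 1)) * ∫⁻ n, squareFunction v (k + 1) f n ^ (2 : ℝ) :=
        lintegral_const_mul' _ _ ENNReal.ofReal_ne_top
    _ ≤ ENNReal.ofReal (ε ^ (2 * k + 1)) * (C * ∫⁻ n, ‖f n‖ₑ ^ (2 : ℝ)) :=
        mul_le_mul_right (hS f) _
    _ = _ := by ring

theorem exists_strongType_radialSup_of_diffMaximal (hv : 1 ≤ v) (k : ℕ) {q σ : ℝ} (hq : 1 < q)
    (hσ0 : 0 < σ) (hσ1 : σ < 1) {C : ℝ≥0∞} (hC : C ≠ ∞)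
    (h : ∀ i, StrongType (diffMaximal v k i) q (C * ENNReal.ofReal σ ^ i)) :
    ∃ C : ℝ≥0∞, C ≠ ∞ ∧ StrongType (radialSup fun f : 𝓢(N v, ℂ) => sphMean f) q C := by
  have hq0 : 0 < q := one_pos.trans hq
  have hm := profileMass_pos k
  obtain ⟨C₁, hC₁, h₁⟩ := exists_strongType_coarseMaximal hv k hq
  obtain ⟨K, hK, hK'⟩ := exists_lintegral_tsum_rpow_le (volume : Measure (N v)) hq0 hσ0 hσ1
  set c := ENNReal.ofReal (profileMass k)⁻¹ ^ q * (2 : ℝ≥0∞) ^ (q - 1) with hc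
  -- The power of two in `c` is that of `(a + b)^q ≤ 2^(q-1) (a^q + b^q)`.
  have hc_top : c ≠ ∞ := ENNReal.mul_ne_top
    (ENNReal.rpow_ne_top_of_nonneg hq0.le ENNReal.ofReal_ne_top)
    (ENNReal.rpow_ne_top_of_nonneg (by linarith) ENNReal.ofNat_ne_top)
  refine ⟨c * (C₁ + K * C), ENNReal.mul_ne_top hc_top
    (ENNReal.add_ne_top.2 ⟨hC₁, ENNReal.mul_ne_top hK hC⟩), fun f => ?_⟩
  have hpt : ∀ n, radialSup (fun f : 𝓢(N v, ℂ) => sphMean f) f n ^ q ≤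
      c * (coarseMaximal v k f n ^ q + (∑' i, diffMaximal v k i f n) ^ q) := by
    intro n
    have h1 : radialSup (fun f : 𝓢(N v, ℂ) => sphMean f) f n ≤
        ENNReal.ofReal (profileMass k)⁻¹ *
          (coarseMaximal v k f n + ∑' i, diffMaximal v k i f n) := by
      refine le_trans (le_of_eq ?_) (mul_le_mul_right (profileMass_mul_radialSup_le hv k f n) _)
      rw [← mul_assoc, ← ENNReal.ofReal_mul (by positivity), inv_mul_cancel₀ hm.ne',
        ENNReal.ofReal_one, one_mul]
    refine (ENNReal.rpow_le_rpow h1 hq0.le).trans ?_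
    rw [ENNReal.mul_rpow_of_nonneg _ _ hq0.le, hc, mul_assoc]
    exact mul_le_mul_right (ENNReal.rpow_add_le_mul_rpow_add_rpow _ _ hq.le) _
  have hI : ∫⁻ n, (∑' i, diffMaximal v k i f n) ^ q ≤ K * (C * ∫⁻ n, ‖f n‖ₑ ^ q) := by
    refine hK' _ _ (fun i => (isSubadditiveOp_diffMaximal k i).measurable f) fun i => ?_
    exact (h i f).trans_eq (by ring)
  calc _ ≤ ∫⁻ n, c * (coarseMaximal v k f n ^ q + (∑' i, diffMaximal v k i f n) ^ q) :=
        lintegral_mono hpt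
    _ = c * ((∫⁻ n, coarseMaximal v k f n ^ q) + ∫⁻ n, (∑' i, diffMaximal v k i f n) ^ q) := by
        rw [lintegral_const_mul' _ _ hc_top, lintegral_add_left
          (((isSubadditiveOp_coarseMaximal k).measurable f).pow_const q)]
    _ ≤ c * (C₁ * (∫⁻ n, ‖f n‖ₑ ^ q) + K * (C * ∫⁻ n, ‖f n‖ₑ ^ q)) :=
        mul_le_mul_right (add_le_add (h₁ f) hI) _
    _ = _ := by ring

/-- Interpolates the loss `ε⁻¹` at exponent `1` with the gain `ε^(2k+1)` in squared norm at exponent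
`2`, where `ε = 2⁻ⁱ`. -/
theorem strongType_diffMaximal (hv : 1 ≤ v) (k : ℕ) {C : ℝ≥0∞} (hC : C ≠ ∞)
    (hS : StrongType (fun f : 𝓢(N v, ℂ) => squareFunction v (k + 1) f) 2 C) {q : ℝ} (hq1 : 1 < q)
    (hq2 : q < 2) :
    ∃ D : ℝ≥0∞, D ≠ ∞ ∧ ∀ i, StrongType (diffMaximal v k i) q
      (D * ENNReal.ofReal ((1 / 2) ^ (2 * (k + 1) * (q - 1) - 1)) ^ i) := by
  have hP := profileBound_pos k
  have hq1' : 0 < q - 1 := by linarith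
  have hq2' : 0 < 2 - q := by linarith
  set A : ℝ := 3 * profileBound k * 6 ^ homDim v with hA
  have hA0 : 0 < A := by positivity
  refine ⟨ENNReal.ofReal q *
    (weakConst v * ENNReal.ofReal A * ENNReal.ofReal (2 ^ (1 : ℝ)) * ENNReal.ofReal (q - 1)⁻¹ +
      C * ENNReal.ofReal (2 ^ (2 : ℝ)) * ENNReal.ofReal (2 ^ (2 - q) / (2 - q))), ?_, fun i => ?_⟩
  · refine ENNReal.mul_ne_top ENNReal.ofReal_ne_top (ENNReal.add_ne_top.2 ⟨?_, ?_⟩)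
    · exact ENNReal.mul_ne_top (ENNReal.mul_ne_top (ENNReal.mul_ne_top weakConst_ne_top
        ENNReal.ofReal_ne_top) ENNReal.ofReal_ne_top) ENNReal.ofReal_ne_top
    · exact ENNReal.mul_ne_top (ENNReal.mul_ne_top hC ENNReal.ofReal_ne_top) ENNReal.ofReal_ne_top
  set ε : ℝ := (1 / 2) ^ i with hε
  have hε0 : 0 < ε := by positivity
  set γ : ℝ := 2 * (k + 1) * (q - 1) - 1 with hγ
  have hσ : ENNReal.ofReal ((1 / 2) ^ γ) ^ i = ENNReal.ofReal (ε ^ γ) := by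
    rw [← ENNReal.ofReal_pow (by positivity), hε, ← Real.rpow_natCast, ← Real.rpow_natCast,
      ← Real.rpow_mul (by norm_num), ← Real.rpow_mul (by norm_num), mul_comm γ]
  have h2 := (strongType_two_diffMaximal hv k i hS).weakType two_pos
    (isSubadditiveOp_diffMaximal k i).measurable
  -- The cut height `b = ε^(-2(k+1))` is the ratio of the two constants: it balances `ε⁻¹ b^(1-q)`
  -- with `ε^(2k+1) b^(2-q)`, both then equal to `ε^γ`.
  have h := (weakType_one_diffMaximal hv k i).strongType_of_weakType
    (isSubadditiveOp_diffMaximal k i) h2 one_pos hq1 hq2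
    (b := ε ^ (-(2 * (k + 1) : ℝ))) (by positivity)
    (ENNReal.mul_ne_top weakConst_ne_top ENNReal.ofReal_ne_top)
    (ENNReal.mul_ne_top hC ENNReal.ofReal_ne_top)
  rw [← hε] at h
  have e1 : ENNReal.ofReal (A * ε⁻¹) *
      ENNReal.ofReal ((ε ^ (-(2 * (k + 1) : ℝ))) ^ (1 - q) / (q - 1)) =
      ENNReal.ofReal A * ENNReal.ofReal (q - 1)⁻¹ * ENNReal.ofReal (ε ^ γ) := by
    rw [← ENNReal.ofReal_mul (by positivity), ← ENNReal.ofReal_mul (by positivity),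
      ← ENNReal.ofReal_mul (by positivity)]
    congr 1
    have : ε ^ γ = ε⁻¹ * (ε ^ (-(2 * (k + 1) : ℝ))) ^ (1 - q) := by
      rw [← Real.rpow_neg_one, ← Real.rpow_mul hε0.le, ← Real.rpow_add hε0, hγ]
      congr 1
      ring
    rw [this]
    ring
  have e2 : ENNReal.ofReal (ε ^ (2 * k + 1)) *
      ENNReal.ofReal ((2 * ε ^ (-(2 * (k + 1) : ℝ))) ^ (2 - q) / (2 - q)) =
      ENNReal.ofReal (2 ^ (2 - q) / (2 - q)) * ENNReal.ofReal (ε ^ γ) := by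
    rw [← ENNReal.ofReal_mul (by positivity), ← ENNReal.ofReal_mul (by positivity)]
    congr 1
    have : ε ^ γ = ε ^ (2 * k + 1) * (ε ^ (-(2 * (k + 1) : ℝ))) ^ (2 - q) := by
      rw [← Real.rpow_natCast ε (2 * k + 1), ← Real.rpow_mul hε0.le, ← Real.rpow_add hε0, hγ]
      congr 1
      push_cast
      ring
    rw [this, Real.mul_rpow two_pos.le (by positivity)]
    ring
  convert h using 1
  rw [hσ]
  calc _ = ENNReal.ofReal q * (weakConst v * ENNReal.ofReal (2 ^ (1 : ℝ)) *
        (ENNReal.ofReal A * ENNReal.ofReal (q - 1)⁻¹ * ENNReal.ofReal (ε ^ γ)) +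
        C * ENNReal.ofReal (2 ^ (2 : ℝ)) *
        (ENNReal.ofReal (2 ^ (2 - q) / (2 - q)) * ENNReal.ofReal (ε ^ γ))) := by ring
    _ = _ := by
      rw [← e1, ← e2]
      ring

theorem lpInequality_sphericalMaximal_of_strongType {p q : ℝ} (hp : 0 < p) {C : ℝ≥0∞} (hC : C ≠ ∞)
    (h : StrongType (radialSup fun f : 𝓢(N v, ℂ) => sphMean f) p C) (hpq : p ≤ q) :
    LpInequality (sphericalMaximal v) (ENNReal.ofReal q) := by
  have hsub := (isRadialFamily_sphMean (v := v)).isSubadditiveOp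
  have key : ∃ C : ℝ≥0∞, C ≠ ∞ ∧ StrongType (radialSup fun f : 𝓢(N v, ℂ) => sphMean f) q C := by
    rcases hpq.eq_or_lt with rfl | hlt
    · exact ⟨C, hC, h⟩
    · exact (h.weakType hp hsub.measurable).strongType_of_bounded hsub hp hlt
        (by positivity : 0 < (sphereMeasure v).real univ + 1) hC
        isRadialFamily_sphMean.radialSup_le
  obtain ⟨D, hD, h'⟩ := key
  refine StrongType.lpInequality (hp.trans_le hpq) hD fun f => ?_
  simp only [sphericalMaximal_eq_radialSup]
  exact h' f

end KoranyiSphere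

/-! ### The theorem -/

open KoranyiSphere in
theorem theorem3 (v : ℕ) (hv : 2 ≤ v) :
    (LpInequality (squareFunction v 1) 2 →
      ∀ p : ℝ≥0∞, 2 ≤ p → LpInequality (sphericalMaximal v) p) ∧
    (2 < v → ∀ h : ℕ, 1 < h → (h : ℝ) < ((homDim v : ℝ) - 2) / 2 →
      (∀ j : ℕ, 1 < j → j ≤ h → LpInequality (squareFunction v j) 2) →
      ∀ p : ℝ≥0∞, ENNReal.ofReal (2 * h / (2 * h - 1)) < p →
        LpInequality (sphericalMaximal v) p) := by
  have hv1 : 1 ≤ v := one_le_two.trans hv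
  have e2 : (2 : ℝ≥0∞) = ENNReal.ofReal 2 := by simp
  refine ⟨fun hS p hp => ?_, fun _ h hh _ hS p hp => ?_⟩
  · by_cases hptop : p = ∞
    · rw [hptop]
      exact lpInequality_sphericalMaximal_top
    rw [e2] at hS hp
    obtain ⟨C, _, hC⟩ := hS.exists_strongType two_pos
    -- For `k = 0` the squared `L²` constant at scale `2⁻ⁱ` decays like `2⁻ⁱ`, so no interpolation
    -- between scales is needed.
    obtain ⟨D, hD, hDs⟩ := exists_strongType_radialSup_of_diffMaximal hv1 0 (σ := 1 / 2)
      one_lt_two (by norm_num) (by norm_num) (C := C) ENNReal.coe_ne_top fun i => by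
        have := strongType_two_diffMaximal hv1 0 i hC
        rwa [mul_zero, zero_add, pow_one, ENNReal.ofReal_pow (by norm_num)] at this
    rw [← ENNReal.ofReal_toReal hptop]
    exact lpInequality_sphericalMaximal_of_strongType two_pos hD hDs
      ((ENNReal.ofReal_le_iff_le_toReal hptop).1 hp)
  · by_cases hptop : p = ∞
    · rw [hptop]
      exact lpInequality_sphericalMaximal_top
    have hS' := hS h hh le_rfl
    rw [e2] at hS'
    obtain ⟨C, _, hC⟩ := hS'.exists_strongType two_pos
    have hhR : (2 : ℝ) ≤ h := by exact_mod_cast hh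
    obtain ⟨k, rfl⟩ : ∃ k, h = k + 1 := ⟨h - 1, by omega⟩
    set s : ℝ := 2 * ((k + 1 : ℕ) : ℝ) / (2 * ((k + 1 : ℕ) : ℝ) - 1) with hs
    have hs1 : 1 < s := by
      rw [hs, one_lt_div (by linarith)]
      linarith
    have hs2 : s < 2 := by
      rw [hs, div_lt_iff₀ (by linarith)]
      linarith
    have hsp : s < p.toReal := (ENNReal.ofReal_lt_iff_lt_toReal (by linarith) hptop).1 hp
    -- `q < 2` allows interpolation between the exponents `1` and `2`; `q < p` lets the `L^∞` bound
    -- carry the estimate up to `p`.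
    obtain ⟨q, hsq, hq⟩ := exists_between (lt_min hs2 hsp)
    have hq2 : q < 2 := hq.trans_le (min_le_left _ _)
    have hqp : q < p.toReal := hq.trans_le (min_le_right _ _)
    -- With `h = k + 1`, `q > 2h/(2h-1)` means `2h(q-1) > q`, and `q > 1`.
    have hγ : 0 < 2 * ((k : ℝ) + 1) * (q - 1) - 1 := by
      rw [hs, div_lt_iff₀ (by linarith)] at hsq
      push_cast at hsq hhR
      nlinarith
    obtain ⟨D, hD, hDs⟩ := strongType_diffMaximal hv1 k ENNReal.coe_ne_top hC
      (hs1.trans hsq) hq2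
    obtain ⟨E, hE, hEs⟩ := exists_strongType_radialSup_of_diffMaximal hv1 k (hs1.trans hsq)
      (Real.rpow_pos_of_pos (by norm_num) _)
      (Real.rpow_lt_one (by norm_num) (by norm_num) hγ) hD hDs
    rw [← ENNReal.ofReal_toReal hptop]
    exact lpInequality_sphericalMaximal_of_strongType (by linarith) hE hEs hqp.le
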